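/- **Setting.** Fix predicate symbols $P_1,P_2,\dots$ (all unary) and constants $a_1,a_2,\dots$. A finite unary language $L$ has finitely many of these predicates, all the constants, and no function symbols or equality. $SL$ is its set of first order sentences and $QFSL$ its set of quantifier-free sentences. A *probability function* on $L$ is a map $w:SL\to[0,1]$ such that (P1) $w(\theta)=1$ if $\models\theta$; (P2) $w(\theta\vee\phi)=w(\theta)+w(\phi)$ if $\theta\models\neg\phi$; (P3) $w(\exists x\,\psi(x))=\lim_{n\to\infty}w\big(\bigvee_{j=1}^n\psi(a_j)\big)$. It satisfies - *Ex* if $w(\phi)$ is unchanged when the constants in $\phi$ are permuted by any permutation of $\{a_1,a_2,\dots\}$; - *Px* if $w(\phi)$ is unchanged when the predicates in $\phi$ are permuted by any permutation of the predicates of $L$; - *WIP* if $w(\theta\wedge\phi)=w(\theta)\,w(\phi)$ whenever $\theta,\phi\in QFSL$ have no constants and no predicates in common; - *ULi with WIP* if there are probability functions $w^{\mathcal L}$, one for each finite unary language $\mathcal L$, each satisfying Ex, Px and WIP, such that $w^{\mathcal L}$ restricted to $S\mathcal L'$ is $w^{\mathcal L'}$ whenever $\mathcal L'\subseteq\mathcal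 L$, and $w=w^{L}$. An *atom* $\alpha$ of $L$ is a choice, for each predicate $P$ of $L$, of $P(x)$ or $\neg P(x)$, and also the conjunction of the chosen formulas. A *state description* of $L$ is a sentence $\Theta=\bigwedge_{j=1}^n\alpha_{h_j}(a_{i_j})$ with distinct constants $a_{i_j}$ and atoms $\alpha_{h_j}$. For a vector $\vec c=(c_\alpha)$ indexed by the atoms of $L$ put $w_{\vec c}(\Theta)=\prod_{\alpha}c_\alpha^{\,|\{j\,:\,\alpha_{h_j}=\alpha\}|}$. Let $L$ have $q$ predicates, listed as $Q_1,\dots,Q_q$. For $N\ge 1$ a state description $\Upsilon$ of $\{P_1,\dots,P_N\}$ for $a_1,\dots,a_N$ is an $N\times N$ matrix with entries in $\{0,1\}$, the entry $(i,j)$ being $1$ iff $\Upsilon\models P_i(a_j)$. For $e:\{1,\dots,q\}\to\{1,\dots,N\}$ let $\vec c^{\,e}$ be the vector whose entry $c^{\,e}_\alpha$ is $\frac1N$ times the number of columns $j$ such that, for each $k\le q$, the entry $(e(k),j)$ of $\Upsilon$ is $1$ iff $Q_k$ occurs unnegated in $\alpha$. Define $$\nabla^L_\Upsilon(\Theta)=\sum_{e:\{1,\dots,q\}\to\{1,\dots,N\}}\frac1{N^q}\,w_{\vec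 c^{\,e}}(\Theta).$$ Work in a nonstandard universe that is an ultrapower of the standard one by an ultrafilter, and let $\nu\in{}^*\mathbb N$ be infinite. By transfer, $\nabla^L_\Upsilon(\Theta)\in{}^*\mathbb R$ is defined for every internal state description $\Upsilon$ of $\{P_1,\dots,P_\nu\}$ for $a_1,\dots,a_\nu$ and every (standard) state description $\Theta$ of $L$. A probability function on $SL$ *is* ${}^\circ\nabla^L_\Upsilon$ if its value at every state description $\Theta$ of $L$ is the standard part of $\nabla^L_\Upsilon(\Theta)$. **Theorem 4.3.** Let $\nu$ be an infinite hypernatural number and $L$ a finite unary language. For every internal state description $\Upsilon$ of $\{P_1,\dots,P_\nu\}$ for $a_1,\dots,a_\nu$ there is exactly one probability function on $SL$ that is ${}^\circ\nabla^L_\Upsilon$. A probability function $w$ on $SL$ satisfies ULi with WIP if and only if $w={}^\circ\nabla^L_\Upsilon$ for some such $\Upsilon$. -/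

import Mathlib

namespace PIL

/-! ### First order unary languages without equality

The predicates are indexed by a type `Pred`, the constants `a 0, a 1, …` by `ℕ`. -/

/-- Terms with free variables among `x 0, …, x (n-1)`. -/
inductive Term (n : ℕ) : Type
  | var (i : Fin n) : Term n
  | const (k : ℕ) : Term n

/-- Formulas with free variables among `x 0, …, x (n-1)`; a quantifier binds the variable `x n`
of a formula in `n + 1` variables. -/
inductive Form (Pred : Type) : ℕ → Type
  | rel {n : ℕ} (P : Pred) (t : Term n) : Form Pred n
  | bot {n : ℕ} : Form Pred n
  | neg {n : ℕ} (φ : Form Pred n) : Form Pred n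
  | and {n : ℕ} (φ ψ : Form Pred n) : Form Pred n
  | or {n : ℕ} (φ ψ : Form Pred n) : Form Pred n
  | imp {n : ℕ} (φ ψ : Form Pred n) : Form Pred n
  | ex {n : ℕ} (φ : Form Pred (n + 1)) : Form Pred n
  | all {n : ℕ} (φ : Form Pred (n + 1)) : Form Pred n

namespace Term

/-- Substitute terms for the variables. -/
def subst {n m : ℕ} (s : Fin n → Term m) : Term n → Term m
  | var i => s i
  | const k => const k

/-- The same term, in one more variable. -/
def lift {n : ℕ} (t : Term n) : Term (n + 1) :=
  t.subst fun i => var i.castSucc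

/-- Rename the constants. -/
def mapConst {n : ℕ} (g : ℕ → ℕ) : Term n → Term n
  | var i => var i
  | const k => const (g k)

/-- The constants occurring in a term. -/
def consts {n : ℕ} : Term n → Set ℕ
  | var _ => ∅
  | const k => {k}

end Term

/-- A structure: the domain is nonempty because the constants have values in it. -/
structure Interp (Pred : Type) where
  Dom : Type
  pred : Pred → Dom → Prop
  const : ℕ → Dom

/-- The value of a term. -/
def Term.eval {Pred : Type} (M : Interp Pred) {n : ℕ} (v : Fin n → M.Dom) : Term n → M.Dom
  | .var i => v i
  | .const k => M.const k

namespace Form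

variable {Pred Pred' : Type}

/-- Simultaneous substitution of terms for the free variables. -/
def subst : {n m : ℕ} → (Fin n → Term m) → Form Pred n → Form Pred m
  | _, _, s, rel P t => rel P (t.subst s)
  | _, _, _, bot => bot
  | _, _, s, neg φ => neg (φ.subst s)
  | _, _, s, and φ ψ => and (φ.subst s) (ψ.subst s)
  | _, _, s, or φ ψ => or (φ.subst s) (ψ.subst s)
  | _, _, s, imp φ ψ => imp (φ.subst s) (ψ.subst s)
  | _, m, s, ex φ => ex (φ.subst (Fin.snoc (fun i => (s i).lift) (Term.var (Fin.last m))))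
  | _, m, s, all φ => all (φ.subst (Fin.snoc (fun i => (s i).lift) (Term.var (Fin.last m))))

/-- The instance `ψ(a k)` of a formula `ψ(x)` in one free variable. -/
def inst (ψ : Form Pred 1) (k : ℕ) : Form Pred 0 :=
  ψ.subst fun _ => Term.const k

/-- Rename the predicates by `f` and the constants by `g`. -/
def map (f : Pred → Pred') (g : ℕ → ℕ) : {n : ℕ} → Form Pred n → Form Pred' n
  | _, rel P t => rel (f P) (t.mapConst g)
  | _, bot => bot
  | _, neg φ => neg (φ.map f g)
  | _, and φ ψ => and (φ.map f g) (ψ.map f g)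
  | _, or φ ψ => or (φ.map f g) (ψ.map f g)
  | _, imp φ ψ => imp (φ.map f g) (ψ.map f g)
  | _, ex φ => ex (φ.map f g)
  | _, all φ => all (φ.map f g)

/-- The predicates occurring in a formula. -/
def preds : {n : ℕ} → Form Pred n → Set Pred
  | _, rel P _ => {P}
  | _, bot => ∅
  | _, neg φ => φ.preds
  | _, and φ ψ => φ.preds ∪ ψ.preds
  | _, or φ ψ => φ.preds ∪ ψ.preds
  | _, imp φ ψ => φ.preds ∪ ψ.preds
  | _, ex φ => φ.preds
  | _, all φ => φ.preds

/-- The constants occurring in a formula. -/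
def consts : {n : ℕ} → Form Pred n → Set ℕ
  | _, rel _ t => t.consts
  | _, bot => ∅
  | _, neg φ => φ.consts
  | _, and φ ψ => φ.consts ∪ ψ.consts
  | _, or φ ψ => φ.consts ∪ ψ.consts
  | _, imp φ ψ => φ.consts ∪ ψ.consts
  | _, ex φ => φ.consts
  | _, all φ => φ.consts

/-- Quantifier-free formulas. -/
def IsQF : {n : ℕ} → Form Pred n → Prop
  | _, rel _ _ => True
  | _, bot => True
  | _, neg φ => φ.IsQF
  | _, and φ ψ => φ.IsQF ∧ ψ.IsQF
  | _, or φ ψ => φ.IsQF ∧ ψ.IsQF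
  | _, imp φ ψ => φ.IsQF ∧ ψ.IsQF
  | _, ex _ => False
  | _, all _ => False

/-- Tarski's truth definition. -/
def Realize (M : Interp Pred) : {n : ℕ} → Form Pred n → (Fin n → M.Dom) → Prop
  | _, rel P t, v => M.pred P (t.eval M v)
  | _, bot, _ => False
  | _, neg φ, v => ¬ φ.Realize M v
  | _, and φ ψ, v => φ.Realize M v ∧ ψ.Realize M v
  | _, or φ ψ, v => φ.Realize M v ∨ ψ.Realize M v
  | _, imp φ ψ, v => φ.Realize M v → ψ.Realize M v
  | _, ex φ, v => ∃ d : M.Dom, φ.Realize M (Fin.snoc v d)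
  | _, all φ, v => ∀ d : M.Dom, φ.Realize M (Fin.snoc v d)

/-- Finite conjunctions; the empty one is `¬ ⊥`. -/
def conj {n : ℕ} : List (Form Pred n) → Form Pred n
  | [] => neg bot
  | φ :: l => and φ (conj l)

/-- Finite disjunctions; the empty one is `⊥`. -/
def disj {n : ℕ} : List (Form Pred n) → Form Pred n
  | [] => bot
  | φ :: l => or φ (disj l)

end Form

/-- The sentences of the language whose predicates are indexed by `Pred`. -/
abbrev Sentence (Pred : Type) : Type := Form Pred 0

/-- Truth of a sentence in a structure. -/
def Models {Pred : Type} (M : Interp Pred) (θ : Sentence Pred) : Prop :=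
  θ.Realize M Fin.elim0

/-- `⊨ θ`. -/
def Valid {Pred : Type} (θ : Sentence Pred) : Prop :=
  ∀ M : Interp Pred, Models M θ

/-- `θ ⊨ φ`. -/
def Entails {Pred : Type} (θ φ : Sentence Pred) : Prop :=
  ∀ M : Interp Pred, Models M θ → Models M φ

/-! ### Probability functions and principles

The stock of predicate symbols is `P 0, P 1, …`; a finite unary language is a finite set
`L : Finset ℕ` of indices of predicates, and its set of sentences is `Sentence L`. -/

/-- Probability functions on the sentences of `L`. -/
structure IsProbabilityFunction {L : Finset ℕ} (w : Sentence L → ℝ) : Prop where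
  mem_Icc : ∀ θ, w θ ∈ Set.Icc (0 : ℝ) 1
  valid : ∀ θ, Valid θ → w θ = 1
  add : ∀ θ φ, Entails θ φ.neg → w (θ.or φ) = w θ + w φ
  ex : ∀ ψ : Form L 1,
    Filter.Tendsto (fun n : ℕ => w (Form.disj ((List.range n).map fun j => ψ.inst j)))
      Filter.atTop (nhds (w ψ.ex))

/-- Constant Exchangeability, Ex. -/
def ConstantExchangeable {L : Finset ℕ} (w : Sentence L → ℝ) : Prop :=
  ∀ (σ : Equiv.Perm ℕ) (φ : Sentence L), w (φ.map id σ) = w φ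

/-- Predicate Exchangeability, Px. -/
def PredicateExchangeable {L : Finset ℕ} (w : Sentence L → ℝ) : Prop :=
  ∀ (σ : Equiv.Perm L) (φ : Sentence L), w (φ.map σ id) = w φ

/-- The Weak Irrelevance Principle, WIP. -/
def WeakIrrelevance {L : Finset ℕ} (w : Sentence L → ℝ) : Prop :=
  ∀ θ φ : Sentence L, θ.IsQF → φ.IsQF →
    Disjoint θ.consts φ.consts → Disjoint θ.preds φ.preds →
    w (θ.and φ) = w θ * w φ

/-- A sentence of a sublanguage, as a sentence of the larger language. -/
def Sentence.incl {L' L : Finset ℕ} (h : L' ⊆ L) (φ : Sentence L') : Sentence L :=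
  φ.map (fun P => ⟨P.1, h P.2⟩) id

/-- `w` satisfies Unary Language Invariance (ULi) with the principle `Q`. -/
def ULiWith (Q : ∀ L : Finset ℕ, (Sentence L → ℝ) → Prop) {L : Finset ℕ}
    (w : Sentence L → ℝ) : Prop :=
  ∃ W : ∀ L' : Finset ℕ, Sentence L' → ℝ,
    (∀ L', IsProbabilityFunction (W L') ∧ ConstantExchangeable (W L') ∧
      PredicateExchangeable (W L') ∧ Q L' (W L')) ∧
    (∀ (L₁ L₂ : Finset ℕ) (h : L₁ ⊆ L₂) (φ : Sentence L₁), W L₂ (φ.incl h) = W L₁ φ) ∧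
    W L = w

/-! ### State descriptions -/

/-- An atom of `L`, given by the exponents of its predicates: `true` for `P`, `false` for `¬ P`. -/
abbrev Atom (L : Finset ℕ) : Type := L → Bool

/-- The sentence `α(a k)`, with the predicates of `L` in increasing order. -/
def Atom.sentence {L : Finset ℕ} (α : Atom L) (k : ℕ) : Sentence L :=
  Form.conj (((Finset.univ : Finset L).sort (· ≤ ·)).map fun P =>
    if α P then Form.rel P (Term.const k) else (Form.rel P (Term.const k)).neg)

/-- The state description `⋀ j, α_{h j}(a (c j))` for the distinct constants `a (c j)`. -/
def stateDescription {L : Finset ℕ} {n : ℕ} (h : Fin n → Atom L) (c : Fin n ↪ ℕ) : Sentence L :=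
  Form.conj (List.ofFn fun j => (h j).sentence (c j))

/-- The value of the function `w_x` on state descriptions. -/
def wVec {L : Finset ℕ} (x : Atom L → ℝ) {n : ℕ} (h : Fin n → Atom L) : ℝ :=
  ∏ α : Atom L, x α ^ (Finset.univ.filter fun j => h j = α).card

/-! ### The functions `∇` -/

/-- State descriptions of `P_1, …, P_N` for `a_1, …, a_N`, as matrices: the entry in row `i` and
column `j` is the exponent of `P_i` at `a_j`. -/
abbrev SquareDescription (N : ℕ) : Type := Fin N → Fin N → Bool

/-- The frequency vector of the columns of the matrix whose row `P` is row `e P` of `M`. -/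
noncomputable def rowFreq {N : ℕ} (M : SquareDescription N) {L : Finset ℕ} (e : L → Fin N) :
    Atom L → ℝ :=
  fun α => ((Finset.univ.filter fun j : Fin N => ∀ P : L, M (e P) j = α P).card : ℝ) / N

/-- `∇` for a description of finite size `N`, on the state description with atoms `h`. -/
noncomputable def nabla {N : ℕ} (M : SquareDescription N) {L : Finset ℕ} {n : ℕ}
    (h : Fin n → Atom L) : ℝ :=
  ∑ e : L → Fin N, 1 / (N : ℝ) ^ L.card * wVec (rowFreq M e) h

/-- The nonstandard universe is an ultrapower, with `*A = Germ U A`. An element of this type is a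
state description of `L_ν` for `ν` constants in the sense of the nonstandard universe, that is, an
element of `*(⋃ N, SquareDescription N)` whose size is the hypernatural number `ν`. -/
def HyperDescription {ι : Type*} (U : Ultrafilter ι) (ν : (U : Filter ι).Germ ℕ) : Type _ :=
  {Υ : (U : Filter ι).Germ (Σ N : ℕ, SquareDescription N) // Υ.map Sigma.fst = ν}

/-- The hyperreal value of `∇` at a standard state description: the nonstandard extension of
`M ↦ nabla M h`, evaluated at `Υ`. -/
noncomputable def hyperNabla {ι : Type*} {U : Ultrafilter ι} {ν : (U : Filter ι).Germ ℕ}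
    (Υ : HyperDescription U ν) {L : Finset ℕ} {n : ℕ} (h : Fin n → Atom L) :
    (U : Filter ι).Germ ℝ :=
  Υ.1.map fun M => nabla M.2 h

/-- `w` is the function `°∇` of `Υ`: the probability function on the sentences of `L` that on state
descriptions is the standard part of `∇`. -/
def IsStdNabla {ι : Type*} {U : Ultrafilter ι} {ν : (U : Filter ι).Germ ℕ}
    (Υ : HyperDescription U ν) {L : Finset ℕ} (w : Sentence L → ℝ) : Prop :=
  IsProbabilityFunction w ∧
    ∀ (n : ℕ) (h : Fin n → Atom L) (c : Fin n ↪ ℕ),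
      w (stateDescription h c) = ArchimedeanClass.stdPart (hyperNabla Υ h)

end PIL

namespace PIL

/-! ### Semantics -/

section Semantics

variable {Pred Pred' : Type}

/-! For a finite matrix `M`, ∇ is a sampling probability: draw rows for the predicates and columns
for the constants independently, uniformly and with replacement, and read off the entries
(`nabla_eq_sum`, `sampleMeasure_stateDescription`). The law `sampleMeasure M` on infinite 0-1 arrays
is row and column exchangeable, and it is dissociated because disjoint sets of indices use
independent draws.

From Υ to a probability function: the space of arrays is compact, so the laws of the matrices
representing Υ converge weakly along the ultrafilter. Quantifier-free sentences define clopen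
events, so exchangeability and dissociation survive in the limit, and the limit gives each state
description the standard part of ∇ (`exists_measure_isStdNabla`). This one measure serves all
languages, which gives ULi with WIP. Uniqueness is Gaifman's theorem, `eq_of_stateDescription`: up
to small probability, every sentence agrees with a quantifier-free one.

From ULi with WIP to Υ: let the function for the first `N` predicates choose a random `N × N`
corner. On the corner, ∇ is an average of indicators over choices of rows and columns. By Ex and Px
each injective choice has the right mean, and by WIP two disjoint choices are uncorrelated. All but
a vanishing fraction of pairs of choices are of this kind, so the mean square error tends to 0
(`sum_cornerWeight_mul_sq_le`). There are only countably many state descriptions, so one matrix per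
`N` can be good for all of them in the limit (`exists_seq_tendsto_zero`). Evaluating this sequence
at ν gives Υ. -/

theorem Term.eval_subst (M : Interp Pred) {n m : ℕ} (s : Fin n → Term m) (t : Term n)
    (v : Fin m → M.Dom) : (t.subst s).eval M v = t.eval M fun i => (s i).eval M v := by
  cases t <;> rfl

theorem Term.eval_snoc_subst (M : Interp Pred) {n m : ℕ} (s : Fin n → Term m)
    (v : Fin m → M.Dom) (d : M.Dom) :
    (fun i => Term.eval M (Fin.snoc v d)
      ((Fin.snoc (fun i => (s i).lift) (Term.var (Fin.last m)) : Fin (n + 1) → Term (m + 1)) i)) =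
    Fin.snoc (fun i => (s i).eval M v) d := by
  funext i
  refine Fin.lastCases ?_ (fun i => ?_) i
  · simp [Term.eval]
  · cases h : s i <;> simp [Term.lift, Term.subst, Term.eval, h]

namespace Form

theorem realize_subst (M : Interp Pred) {n : ℕ} (φ : Form Pred n) :
    ∀ {m : ℕ} (s : Fin n → Term m) (v : Fin m → M.Dom),
      (φ.subst s).Realize M v ↔ φ.Realize M fun i => (s i).eval M v := by
  induction φ with
  | rel P t => intro m s v; simp [subst, Realize, Term.eval_subst]
  | bot => intro m s v; simp [subst, Realize]
  | neg φ ih => intro m s v; simp [subst, Realize, ih]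
  | and φ ψ ih ih' => intro m s v; simp [subst, Realize, ih, ih']
  | or φ ψ ih ih' => intro m s v; simp [subst, Realize, ih, ih']
  | imp φ ψ ih ih' => intro m s v; simp [subst, Realize, ih, ih']
  | ex φ ih => intro m s v; simp only [subst, Realize, ih, Term.eval_snoc_subst]
  | all φ ih => intro m s v; simp only [subst, Realize, ih, Term.eval_snoc_subst]

/-- The reduct of a structure along renamings of predicates and constants. -/
def _root_.PIL.Interp.comap (f : Pred → Pred') (g : ℕ → ℕ) (M : Interp Pred') : Interp Pred where
  Dom := M.Dom
  pred P := M.pred (f P)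
  const k := M.const (g k)

theorem realize_map (M : Interp Pred') (f : Pred → Pred') (g : ℕ → ℕ) {n : ℕ} (φ : Form Pred n) :
    ∀ v : Fin n → M.Dom, (φ.map f g).Realize M v ↔ φ.Realize (M.comap f g) v := by
  induction φ with
  | rel P t => intro v; cases t <;> rfl
  | bot => intro v; rfl
  | neg φ ih => intro v; simp only [map, Realize, ih]
  | and φ ψ ih ih' => intro v; simp only [map, Realize, ih, ih']
  | or φ ψ ih ih' => intro v; simp only [map, Realize, ih, ih']
  | imp φ ψ ih ih' => intro v; simp only [map, Realize, ih, ih']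
  | ex φ ih => intro v; simp only [map, Realize, ih]; rfl
  | all φ ih => intro v; simp only [map, Realize, ih]; rfl

theorem realize_iff_of_surjective {M M' : Interp Pred} (F : M.Dom → M'.Dom)
    (hF : Function.Surjective F) (hpred : ∀ P d, M.pred P d ↔ M'.pred P (F d))
    (hconst : ∀ k, F (M.const k) = M'.const k) {n : ℕ} (φ : Form Pred n) :
    ∀ v : Fin n → M.Dom, φ.Realize M v ↔ φ.Realize M' fun i => F (v i) := by
  have snoc (n : ℕ) (v : Fin n → M.Dom) (d : M.Dom) :
      (fun i => F ((Fin.snoc v d : Fin (n + 1) → M.Dom) i)) = Fin.snoc (fun i => F (v i)) (F d) := by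
    funext i
    refine Fin.lastCases ?_ (fun i => ?_) i <;> simp
  induction φ with
  | rel P t => intro v; cases t <;> simp [Realize, Term.eval, hpred, hconst]
  | bot => intro v; rfl
  | neg φ ih => intro v; simp only [Realize, ih]
  | and φ ψ ih ih' => intro v; simp only [Realize, ih, ih']
  | or φ ψ ih ih' => intro v; simp only [Realize, ih, ih']
  | imp φ ψ ih ih' => intro v; simp only [Realize, ih, ih']
  | ex φ ih => intro v; simp only [Realize, ih, snoc, hF.exists]
  | all φ ih => intro v; simp only [Realize, ih, snoc, hF.forall]

/-- The hypothesis `hn` expresses `n = 0` without fixing the index, so that induction on the formula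
applies. -/
theorem IsQF.realize_congr {M M' : Interp Pred} {n : ℕ} {φ : Form Pred n}
    (hφ : φ.IsQF)
    (h : ∀ P ∈ φ.preds, ∀ k ∈ φ.consts,
      (M.pred P (M.const k) ↔ M'.pred P (M'.const k)))
    (v : Fin n → M.Dom) (v' : Fin n → M'.Dom) (hn : Fin n → False) :
    φ.Realize M v ↔ φ.Realize M' v' := by
  induction φ with
  | rel P t =>
    cases t with
    | var i => exact (hn i).elim
    | const k => exact h P rfl k rfl
  | bot => rfl
  | neg φ ih => exact not_congr (ih hφ h v v' hn)
  | and φ ψ ih ih' =>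
    exact and_congr
      (ih hφ.1 (fun P hP k hk => h P (Or.inl hP) k (Or.inl hk)) v v' hn)
      (ih' hφ.2 (fun P hP k hk => h P (Or.inr hP) k (Or.inr hk)) v v' hn)
  | or φ ψ ih ih' =>
    exact or_congr
      (ih hφ.1 (fun P hP k hk => h P (Or.inl hP) k (Or.inl hk)) v v' hn)
      (ih' hφ.2 (fun P hP k hk => h P (Or.inr hP) k (Or.inr hk)) v v' hn)
  | imp φ ψ ih ih' =>
    exact imp_congr
      (ih hφ.1 (fun P hP k hk => h P (Or.inl hP) k (Or.inl hk)) v v' hn)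
      (ih' hφ.2 (fun P hP k hk => h P (Or.inr hP) k (Or.inr hk)) v v' hn)
  | ex φ => exact hφ.elim
  | all φ => exact hφ.elim

theorem realize_conj (M : Interp Pred) {n : ℕ} (l : List (Form Pred n)) (v : Fin n → M.Dom) :
    (conj l).Realize M v ↔ ∀ φ ∈ l, φ.Realize M v := by
  induction l with
  | nil => simp [conj, Realize]
  | cons φ l ih => simp [conj, Realize, ih]

theorem realize_disj (M : Interp Pred) {n : ℕ} (l : List (Form Pred n)) (v : Fin n → M.Dom) :
    (disj l).Realize M v ↔ ∃ φ ∈ l, φ.Realize M v := by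
  induction l with
  | nil => simp [disj, Realize]
  | cons φ l ih => simp [disj, Realize, ih]

theorem finite_consts {n : ℕ} (φ : Form Pred n) : φ.consts.Finite := by
  induction φ with
  | rel P t => cases t <;> simp [consts, Term.consts]
  | bot => simp [consts]
  | neg φ ih => exact ih
  | and φ ψ ih ih' => exact ih.union ih'
  | or φ ψ ih ih' => exact ih.union ih'
  | imp φ ψ ih ih' => exact ih.union ih'
  | ex φ ih => exact ih
  | all φ ih => exact ih

theorem finite_preds {n : ℕ} (φ : Form Pred n) : φ.preds.Finite := by
  induction φ with
  | rel P t => simp [preds]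
  | bot => simp [preds]
  | neg φ ih => exact ih
  | and φ ψ ih ih' => exact ih.union ih'
  | or φ ψ ih ih' => exact ih.union ih'
  | imp φ ψ ih ih' => exact ih.union ih'
  | ex φ ih => exact ih
  | all φ ih => exact ih

theorem isQF_conj {n : ℕ} {l : List (Form Pred n)} (h : ∀ φ ∈ l, φ.IsQF) : (conj l).IsQF := by
  induction l with
  | nil => trivial
  | cons φ l ih => exact ⟨h φ (by simp), ih fun ψ hψ => h ψ (by simp [hψ])⟩

theorem isQF_map (f : Pred → Pred') (g : ℕ → ℕ) {n : ℕ} {φ : Form Pred n} (h : φ.IsQF) :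
    (φ.map f g).IsQF := by
  induction φ with
  | rel P t => trivial
  | bot => trivial
  | neg φ ih => exact ih h
  | and φ ψ ih ih' => exact ⟨ih h.1, ih' h.2⟩
  | or φ ψ ih ih' => exact ⟨ih h.1, ih' h.2⟩
  | imp φ ψ ih ih' => exact ⟨ih h.1, ih' h.2⟩
  | ex φ => exact h.elim
  | all φ => exact h.elim

theorem preds_map (f : Pred → Pred') (g : ℕ → ℕ) {n : ℕ} (φ : Form Pred n) :
    (φ.map f g).preds = f '' φ.preds := by
  induction φ with
  | rel P t => simp [map, preds]
  | bot => simp [map, preds]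
  | neg φ ih => exact ih
  | and φ ψ ih ih' => simp [map, preds, ih, ih', Set.image_union]
  | or φ ψ ih ih' => simp [map, preds, ih, ih', Set.image_union]
  | imp φ ψ ih ih' => simp [map, preds, ih, ih', Set.image_union]
  | ex φ ih => exact ih
  | all φ ih => exact ih

theorem consts_map (f : Pred → Pred') (g : ℕ → ℕ) {n : ℕ} (φ : Form Pred n) :
    (φ.map f g).consts = g '' φ.consts := by
  induction φ with
  | rel P t => cases t <;> simp [map, consts, Term.mapConst, Term.consts]
  | bot => simp [map, consts]
  | neg φ ih => exact ih
  | and φ ψ ih ih' => simp [map, consts, ih, ih', Set.image_union]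
  | or φ ψ ih ih' => simp [map, consts, ih, ih', Set.image_union]
  | imp φ ψ ih ih' => simp [map, consts, ih, ih', Set.image_union]
  | ex φ ih => exact ih
  | all φ ih => exact ih

end Form

theorem models_map (M : Interp Pred') (f : Pred → Pred') (g : ℕ → ℕ) (φ : Sentence Pred) :
    Models M (φ.map f g) ↔ Models (M.comap f g) φ := by
  rw [Models, Form.realize_map]
  exact iff_of_eq (congrArg _ (Subsingleton.elim _ _))

theorem models_inst (M : Interp Pred) (ψ : Form Pred 1) (k : ℕ) :
    Models M (ψ.inst k) ↔ ψ.Realize M fun _ => M.const k :=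
  Form.realize_subst M ψ _ _

theorem snoc_elim0 {α : Type} (d : α) :
    (Fin.snoc (Fin.elim0 : Fin 0 → α) d : Fin 1 → α) = fun _ => d := by
  funext i
  rw [Fin.eq_zero i]
  exact Fin.snoc_last (α := fun _ : Fin 1 => α) d Fin.elim0

theorem models_ex (M : Interp Pred) (ψ : Form Pred 1) :
    Models M ψ.ex ↔ ∃ d, ψ.Realize M fun _ => d := by
  simp only [Models, Form.Realize]
  exact exists_congr fun d => iff_of_eq (congrArg _ (snoc_elim0 d))

theorem models_congr_of_isQF {M M' : Interp Pred} {φ : Sentence Pred} (hφ : φ.IsQF)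
    (h : ∀ P ∈ φ.preds, ∀ k ∈ φ.consts,
      (M.pred P (M.const k) ↔ M'.pred P (M'.const k))) : Models M φ ↔ Models M' φ :=
  hφ.realize_congr h _ _ Fin.elim0

/-- The structure on the set of constants described by an array of truth values. -/
def arrayInterp (x : Pred → ℕ → Bool) : Interp Pred where
  Dom := ℕ
  pred P k := x P k = true
  const k := k

/-- Renaming constants makes `k` denote `σ k`; the bijection `σ` of the domain is an isomorphism
back to an array structure, so quantifiers cause no trouble. -/
theorem models_arrayInterp_map (x : Pred' → ℕ → Bool) (f : Pred → Pred') (σ : Equiv.Perm ℕ)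
    (φ : Sentence Pred) :
    Models (arrayInterp x) (φ.map f σ) ↔ Models (arrayInterp fun P k => x (f P) (σ k)) φ := by
  rw [models_map]
  symm
  refine (Form.realize_iff_of_surjective (M := arrayInterp fun P k => x (f P) (σ k))
    (M' := (arrayInterp x).comap f σ) σ σ.surjective (fun _ _ => Iff.rfl) (fun _ => rfl)
    φ _).trans ?_
  exact iff_of_eq (congrArg _ (Subsingleton.elim _ _))

end Semantics

/-! ### State descriptions -/

section StateDescriptions

variable {L : Finset ℕ}

theorem models_atomSentence (M : Interp L) (α : Atom L) (k : ℕ) :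
    Models M (α.sentence k) ↔ ∀ P, (M.pred P (M.const k) ↔ α P = true) := by
  rw [Models, Atom.sentence, Form.realize_conj]
  simp only [List.mem_map, Finset.mem_sort, Finset.mem_univ, true_and, forall_exists_index,
    forall_apply_eq_imp_iff]
  refine forall_congr' fun P => ?_
  by_cases h : α P = true <;> simp [h, Form.Realize, Term.eval]

theorem models_stateDescription (M : Interp L) {n : ℕ} (h : Fin n → Atom L) (c : Fin n ↪ ℕ) :
    Models M (stateDescription h c) ↔
      ∀ j P, (M.pred P (M.const (c j)) ↔ h j P = true) := by
  rw [Models, stateDescription, Form.realize_conj]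
  simp only [List.forall_mem_ofFn_iff]
  exact forall_congr' fun j => models_atomSentence M (h j) (c j)

theorem isQF_stateDescription {n : ℕ} (h : Fin n → Atom L) (c : Fin n ↪ ℕ) :
    (stateDescription h c).IsQF := by
  refine Form.isQF_conj ?_
  rw [List.forall_mem_ofFn_iff]
  refine fun j => Form.isQF_conj fun φ hφ => ?_
  obtain ⟨P, -, rfl⟩ := List.mem_map.1 hφ
  split <;> trivial

theorem consts_conj_subset {Pred : Type} {n : ℕ} {l : List (Form Pred n)} {s : Set ℕ}
    (h : ∀ φ ∈ l, φ.consts ⊆ s) : (Form.conj l).consts ⊆ s := by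
  induction l with
  | nil => simp [Form.conj, Form.consts]
  | cons φ l ih =>
    exact Set.union_subset (h φ (by simp)) (ih fun ψ hψ => h ψ (by simp [hψ]))

theorem consts_stateDescription_subset {n : ℕ} (h : Fin n → Atom L) (c : Fin n ↪ ℕ) :
    (stateDescription h c).consts ⊆ Set.range c := by
  refine consts_conj_subset ?_
  rw [List.forall_mem_ofFn_iff]
  refine fun j => consts_conj_subset fun φ hφ => ?_
  obtain ⟨P, -, rfl⟩ := List.mem_map.1 hφ
  split <;> simp [Form.consts, Term.consts]

end StateDescriptions

/-! ### Probability functions -/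

namespace IsProbabilityFunction

variable {L : Finset ℕ} {w w₁ w₂ : Sentence L → ℝ}

theorem apply_neg (hw : IsProbabilityFunction w) (θ : Sentence L) : w θ.neg = 1 - w θ := by
  have h1 := hw.add θ θ.neg fun M h h' => h' h
  rw [hw.valid (θ.or θ.neg) fun M => em _] at h1
  linarith

theorem mono (hw : IsProbabilityFunction w) {θ φ : Sentence L} (h : Entails θ φ) :
    w θ ≤ w φ := by
  have h1 := hw.add θ φ.neg fun M hM h' => h' (h M hM)
  have h2 := (hw.mem_Icc (θ.or φ.neg)).2
  rw [h1, hw.apply_neg] at h2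
  linarith

theorem congr (hw : IsProbabilityFunction w) {θ φ : Sentence L}
    (h : ∀ M : Interp L, Models M θ ↔ Models M φ) : w θ = w φ :=
  le_antisymm (hw.mono fun M => (h M).1) (hw.mono fun M => (h M).2)

theorem le_add (hw : IsProbabilityFunction w) {θ φ ψ : Sentence L}
    (h : ∀ M : Interp L, Models M θ → Models M φ ∨ Models M ψ) : w θ ≤ w φ + w ψ := by
  have h1 : w (φ.or (ψ.and φ.neg)) = w φ + w (ψ.and φ.neg) :=
    hw.add _ _ fun M h1 h2 => h2.2 h1
  have h2 : w (ψ.and φ.neg) ≤ w ψ := hw.mono fun M h => h.1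
  have h3 : w θ ≤ w (φ.or (ψ.and φ.neg)) := by
    refine hw.mono fun M hM => ?_
    by_cases hφ : Models M φ
    · exact Or.inl hφ
    · exact Or.inr ⟨(h M hM).resolve_left hφ, hφ⟩
  linarith

theorem apply_disj (hw : IsProbabilityFunction w) {l : List (Sentence L)}
    (hl : l.Pairwise fun θ φ => Entails θ φ.neg) : w (Form.disj l) = (l.map w).sum := by
  induction l with
  | nil =>
    have := hw.apply_neg (Form.bot : Sentence L)
    rw [hw.valid Form.bot.neg fun M h => h] at this
    simp only [Form.disj, List.map_nil, List.sum_nil]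
    linarith
  | cons θ l ih =>
    rw [List.pairwise_cons] at hl
    rw [Form.disj, hw.add, ih hl.2, List.map_cons, List.sum_cons]
    intro M hM h
    obtain ⟨φ, hφ, h⟩ := (Form.realize_disj M l _).1 h
    exact hl.1 φ hφ M hM h

open Classical in
/-- A quantifier-free sentence has the total probability of the state descriptions
that satisfy it. -/
theorem apply_eq_sum (hw : IsProbabilityFunction w) {θ : Sentence L} (hθ : θ.IsQF) {n : ℕ}
    (hn : ∀ k ∈ θ.consts, k < n) :
    w θ = ∑ h : Fin n → Atom L,
      if Models (arrayInterp fun P k => if hk : k < n then h ⟨k, hk⟩ P else false) θ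
      then w (stateDescription h Fin.valEmbedding) else 0 := by
  rw [← Finset.sum_filter]
  set s := Finset.univ.filter fun h : Fin n → Atom L =>
    Models (arrayInterp fun P k => if hk : k < n then h ⟨k, hk⟩ P else false) θ with hs
  -- The default `false` is never consulted, since all constants of `θ` are below `n`.
  have key (M : Interp L) (h : Fin n → Atom L)
      (hM : Models M (stateDescription h Fin.valEmbedding)) :
      Models M θ ↔
        Models (arrayInterp fun P k => if hk : k < n then h ⟨k, hk⟩ P else false) θ := by
    rw [models_stateDescription] at hM
    refine models_congr_of_isQF hθ fun P _ k hk => ?_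
    refine (hM ⟨k, hn k hk⟩ P).trans ?_
    simp [arrayInterp, hn k hk]
  have h1 : w θ = w (Form.disj (s.toList.map fun h => stateDescription h Fin.valEmbedding)) := by
    refine hw.congr fun M => ?_
    rw [Models, Models, Form.realize_disj]
    constructor
    · intro hM
      let h : Fin n → Atom L := fun j P => decide (M.pred P (M.const j))
      have hh : Models M (stateDescription h Fin.valEmbedding) := by
        rw [models_stateDescription]
        simp [h]
      refine ⟨_, List.mem_map.2 ⟨h, ?_, rfl⟩, hh⟩
      simpa [hs] using (key M h hh).1 hM
    · rintro ⟨φ, hφ, hM⟩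
      obtain ⟨h, hh, rfl⟩ := List.mem_map.1 hφ
      exact (key M h hM).2 (by simpa [hs] using hh)
  rw [h1, hw.apply_disj, List.map_map]
  · exact Finset.sum_map_toList s _
  · rw [List.pairwise_map]
    refine s.nodup_toList.imp fun {h h'} hne M hM hM' => hne ?_
    replace hM' : Models M (stateDescription h' Fin.valEmbedding) := hM'
    rw [models_stateDescription] at hM hM'
    funext j P
    exact Bool.eq_iff_iff.2 ((hM j P).symm.trans (hM' j P))

/-! ### Gaifman's uniqueness theorem, by quantifier-free approximation -/

theorem eq_of_isQF (h₁ : IsProbabilityFunction w₁) (h₂ : IsProbabilityFunction w₂)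
    (h : ∀ (n : ℕ) (h : Fin n → Atom L) (c : Fin n ↪ ℕ),
      w₁ (stateDescription h c) = w₂ (stateDescription h c))
    {θ : Sentence L} (hθ : θ.IsQF) : w₁ θ = w₂ θ := by
  obtain ⟨b, hb⟩ := θ.finite_consts.bddAbove
  have hn : ∀ k ∈ θ.consts, k < b + 1 := fun k hk => Nat.lt_succ_of_le (hb hk)
  rw [h₁.apply_eq_sum hθ hn, h₂.apply_eq_sum hθ hn]
  simp only [h]

/-- The exclusive disjunction of two sentences. -/
def _root_.PIL.symmDiff (θ φ : Sentence L) : Sentence L :=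
  (θ.and φ.neg).or (φ.and θ.neg)

theorem _root_.PIL.models_symmDiff (M : Interp L) (θ φ : Sentence L) :
    Models M (symmDiff θ φ) ↔ ¬(Models M θ ↔ Models M φ) := by
  change (_ ∧ ¬_) ∨ (_ ∧ ¬_) ↔ _
  simp only [Models]
  tauto

/-- `θ` is approximated by quantifier-free sentences simultaneously for `w₁` and `w₂`. -/
def _root_.PIL.QFApproximable (w₁ w₂ : Sentence L → ℝ) (θ : Sentence L) : Prop :=
  ∀ ε > 0, ∃ φ : Sentence L, φ.IsQF ∧ w₁ (symmDiff θ φ) < ε ∧ w₂ (symmDiff θ φ) < ε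

theorem _root_.PIL.QFApproximable.of_isQF (h₁ : IsProbabilityFunction w₁)
    (h₂ : IsProbabilityFunction w₂) {θ : Sentence L} (hθ : θ.IsQF) : QFApproximable w₁ w₂ θ := by
  have aux {w : Sentence L → ℝ} (hw : IsProbabilityFunction w) : w (symmDiff θ θ) = 0 := by
    have := hw.apply_neg (symmDiff θ θ)
    rw [hw.valid (symmDiff θ θ).neg fun M h => (models_symmDiff M θ θ).1 h Iff.rfl] at this
    linarith
  exact fun ε hε => ⟨θ, hθ, by rwa [aux h₁], by rwa [aux h₂]⟩

/-- A truth-functional connective can change value only where one of its arguments does, so the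
errors add. -/
theorem _root_.PIL.QFApproximable.binary (h₁ : IsProbabilityFunction w₁)
    (h₂ : IsProbabilityFunction w₂) (op : Sentence L → Sentence L → Sentence L)
    (hqf : ∀ α β : Sentence L, α.IsQF → β.IsQF → (op α β).IsQF)
    (hop : ∀ (M : Interp L) (α β α' β' : Sentence L), (Models M α ↔ Models M α') →
      (Models M β ↔ Models M β') → (Models M (op α β) ↔ Models M (op α' β')))
    {α β : Sentence L} (hα : QFApproximable w₁ w₂ α) (hβ : QFApproximable w₁ w₂ β) :
    QFApproximable w₁ w₂ (op α β) := by
  intro ε hε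
  obtain ⟨α', hα', ha₁, ha₂⟩ := hα (ε / 2) (by linarith)
  obtain ⟨β', hβ', hb₁, hb₂⟩ := hβ (ε / 2) (by linarith)
  have key (M : Interp L) (hM : Models M (symmDiff (op α β) (op α' β'))) :
      Models M (symmDiff α α') ∨ Models M (symmDiff β β') := by
    rw [models_symmDiff] at hM ⊢
    rw [models_symmDiff]
    by_contra! h
    exact hM (hop M α β α' β' (by tauto) (by tauto))
  refine ⟨op α' β', hqf _ _ hα' hβ', ?_, ?_⟩
  · linarith [h₁.le_add key]
  · linarith [h₂.le_add key]

theorem _root_.PIL.QFApproximable.neg (h₁ : IsProbabilityFunction w₁)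
    (h₂ : IsProbabilityFunction w₂) {α : Sentence L} (hα : QFApproximable w₁ w₂ α) :
    QFApproximable w₁ w₂ α.neg :=
  .binary h₁ h₂ (fun α _ => α.neg) (fun _ _ h _ => h)
    (fun _ _ _ _ _ h _ => not_congr h) hα hα

theorem _root_.PIL.QFApproximable.congr (h₁ : IsProbabilityFunction w₁)
    (h₂ : IsProbabilityFunction w₂) {α β : Sentence L}
    (h : ∀ M : Interp L, Models M α ↔ Models M β) (hα : QFApproximable w₁ w₂ α) :
    QFApproximable w₁ w₂ β := by
  intro ε hε
  obtain ⟨φ, hφ, h1, h2⟩ := hα ε hε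
  have key (M : Interp L) : Models M (symmDiff β φ) ↔ Models M (symmDiff α φ) := by
    rw [models_symmDiff, models_symmDiff, h]
  exact ⟨φ, hφ, by rwa [h₁.congr key], by rwa [h₂.congr key]⟩

theorem _root_.PIL.QFApproximable.disj (h₁ : IsProbabilityFunction w₁)
    (h₂ : IsProbabilityFunction w₂) {l : List (Sentence L)}
    (hl : ∀ θ ∈ l, QFApproximable w₁ w₂ θ) : QFApproximable w₁ w₂ (Form.disj l) := by
  induction l with
  | nil => exact .of_isQF h₁ h₂ trivial
  | cons θ l ih =>
    exact .binary h₁ h₂ Form.or (fun _ _ h h' => ⟨h, h'⟩) (fun _ _ _ _ _ h h' => or_congr h h')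
      (hl θ (by simp)) (ih fun φ hφ => hl φ (by simp [hφ]))

/-- The disjunction entails the existential sentence, so their difference is one-sided; by (P3) it
becomes arbitrarily small. -/
theorem apply_ex_sub (hw : IsProbabilityFunction w) (ψ : Form L 1) (n : ℕ) :
    w (symmDiff ψ.ex (Form.disj ((List.range n).map fun j => ψ.inst j))) =
      w ψ.ex - w (Form.disj ((List.range n).map fun j => ψ.inst j)) := by
  set δ := Form.disj ((List.range n).map fun j => ψ.inst j) with hδ
  have hent : Entails δ ψ.ex := by
    intro M hM
    obtain ⟨φ, hφ, hM⟩ := (Form.realize_disj M _ _).1 hM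
    obtain ⟨j, -, rfl⟩ := List.mem_map.1 hφ
    exact (models_ex M ψ).2 ⟨_, (models_inst M ψ j).1 hM⟩
  have h1 : w (δ.or (symmDiff ψ.ex δ)) = w δ + w (symmDiff ψ.ex δ) := by
    refine hw.add _ _ fun M hM h => ?_
    exact (models_symmDiff M _ _).1 h ⟨fun _ => hM, fun _ => hent M hM⟩
  have h2 : w (δ.or (symmDiff ψ.ex δ)) = w ψ.ex := by
    refine hw.congr fun M => ?_
    change Models M δ ∨ Models M (symmDiff ψ.ex δ) ↔ _
    rw [models_symmDiff]
    have := hent M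
    tauto
  linarith

theorem _root_.PIL.QFApproximable.ex (h₁ : IsProbabilityFunction w₁)
    (h₂ : IsProbabilityFunction w₂) {ψ : Form L 1}
    (h : ∀ k, QFApproximable w₁ w₂ (ψ.inst k)) : QFApproximable w₁ w₂ ψ.ex := by
  intro ε hε
  have aux {w : Sentence L → ℝ} (hw : IsProbabilityFunction w) : ∀ᶠ n : ℕ in Filter.atTop,
      w (symmDiff ψ.ex (Form.disj ((List.range n).map fun j => ψ.inst j))) < ε / 2 := by
    have := (hw.ex ψ).const_sub (w ψ.ex)
    rw [sub_self] at this
    filter_upwards [this.eventually_lt_const (half_pos hε)] with n hn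
    rwa [hw.apply_ex_sub]
  -- A single cut-off `n` works for both functions, as the approximating sentence must be common to
  -- them.
  obtain ⟨n, hn₁, hn₂⟩ := ((aux h₁).and (aux h₂)).exists
  set δ := Form.disj ((List.range n).map fun j => ψ.inst j) with hδ
  have hδ' : QFApproximable w₁ w₂ δ := by
    refine .disj h₁ h₂ fun θ hθ => ?_
    obtain ⟨j, -, rfl⟩ := List.mem_map.1 hθ
    exact h j
  obtain ⟨φ, hφ, hd₁, hd₂⟩ := hδ' (ε / 2) (half_pos hε)
  have key (M : Interp L) (hM : Models M (symmDiff ψ.ex φ)) :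
      Models M (symmDiff ψ.ex δ) ∨ Models M (symmDiff δ φ) := by
    rw [models_symmDiff] at hM ⊢
    rw [models_symmDiff]
    tauto
  exact ⟨φ, hφ, by linarith [h₁.le_add key], by linarith [h₂.le_add key]⟩

/-- Induction on sentences passes through open formulas, so the claim concerns all their closed
instances by constants. -/
theorem qfApproximable_subst (h₁ : IsProbabilityFunction w₁)
    (h₂ : IsProbabilityFunction w₂) {n : ℕ} (φ : Form L n) :
    ∀ s : Fin n → ℕ, QFApproximable w₁ w₂ (φ.subst fun i => (Term.const (s i) : Term 0)) := by
  have inst_snoc {n : ℕ} (φ : Form L (n + 1)) (s : Fin n → ℕ) (k : ℕ) (M : Interp L) :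
      Models M (φ.subst fun i =>
        (Term.const ((Fin.snoc s k : Fin (n + 1) → ℕ) i) : Term 0)) ↔
      Models M ((φ.subst (Fin.snoc (fun i => (Term.const (s i) : Term 0).lift)
        (Term.var (Fin.last 0)))).inst k) := by
    rw [models_inst, Models, Form.realize_subst, Form.realize_subst]
    refine iff_of_eq (congrArg _ (funext fun i => ?_))
    refine Fin.lastCases ?_ (fun i => ?_) i <;> simp [Term.eval, Term.lift, Term.subst]
  induction φ with
  | rel P t => exact fun s => .of_isQF h₁ h₂ trivial
  | bot => exact fun s => .of_isQF h₁ h₂ trivial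
  | neg φ ih => exact fun s => (ih s).neg h₁ h₂
  | and φ ψ ih ih' =>
    exact fun s => .binary h₁ h₂ Form.and (fun _ _ h h' => ⟨h, h'⟩)
      (fun _ _ _ _ _ h h' => and_congr h h') (ih s) (ih' s)
  | or φ ψ ih ih' =>
    exact fun s => .binary h₁ h₂ Form.or (fun _ _ h h' => ⟨h, h'⟩)
      (fun _ _ _ _ _ h h' => or_congr h h') (ih s) (ih' s)
  | imp φ ψ ih ih' =>
    exact fun s => .binary h₁ h₂ Form.imp (fun _ _ h h' => ⟨h, h'⟩)
      (fun _ _ _ _ _ h h' => imp_congr h h') (ih s) (ih' s)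
  | ex φ ih =>
    exact fun s => .ex h₁ h₂ fun k => (ih (Fin.snoc s k)).congr h₁ h₂ (inst_snoc φ s k)
  | all φ ih =>
    intro s
    -- The universal quantifier is treated as `¬∃¬`.
    have := QFApproximable.ex h₁ h₂ (ψ := (φ.subst (Fin.snoc
      (fun i => (Term.const (s i) : Term 0).lift) (Term.var (Fin.last 0)))).neg)
      fun k => ((ih (Fin.snoc s k)).congr h₁ h₂ (inst_snoc φ s k)).neg h₁ h₂
    refine (this.neg h₁ h₂).congr h₁ h₂ fun M => ?_
    simp [Models, Form.Realize, Form.subst]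

theorem qfApproximable (h₁ : IsProbabilityFunction w₁) (h₂ : IsProbabilityFunction w₂)
    (θ : Sentence L) : QFApproximable w₁ w₂ θ := by
  refine (qfApproximable_subst h₁ h₂ θ Fin.elim0).congr h₁ h₂ fun M => ?_
  rw [Models, Form.realize_subst]
  exact iff_of_eq (congrArg _ (Subsingleton.elim _ _))

/-- Gaifman: a probability function is determined by its values on state descriptions. -/
theorem eq_of_stateDescription (h₁ : IsProbabilityFunction w₁) (h₂ : IsProbabilityFunction w₂)
    (h : ∀ (n : ℕ) (h : Fin n → Atom L) (c : Fin n ↪ ℕ),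
      w₁ (stateDescription h c) = w₂ (stateDescription h c)) : w₁ = w₂ := by
  funext θ
  have aux {w : Sentence L → ℝ} (hw : IsProbabilityFunction w) (φ : Sentence L) :
      |w θ - w φ| ≤ w (symmDiff θ φ) := by
    rw [abs_sub_le_iff]
    constructor
    · have := hw.le_add (θ := θ) (φ := φ) (ψ := symmDiff θ φ) fun M hM => by
        rw [models_symmDiff]; tauto
      linarith
    · have := hw.le_add (θ := φ) (φ := θ) (ψ := symmDiff θ φ) fun M hM => by
        rw [models_symmDiff]; tauto
      linarith
  refine eq_of_forall_dist_le fun ε hε => ?_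
  obtain ⟨φ, hφ, h1, h2⟩ := qfApproximable h₁ h₂ θ (ε / 2) (half_pos hε)
  have e := eq_of_isQF h₁ h₂ h hφ
  have a1 := abs_le.1 (aux h₁ φ)
  have a2 := abs_le.1 (aux h₂ φ)
  rw [Real.dist_eq, abs_le]
  constructor <;> linarith [a1.1, a1.2, a2.1, a2.2]

end IsProbabilityFunction

open MeasureTheory ProbabilityTheory Filter Topology

/-! ### Probability functions given by measures on arrays -/

section Arrays

variable {L : Finset ℕ}

/-- The set of arrays, indexed by all predicates and constants, that satisfy a sentence. -/
def event (θ : Sentence L) : Set (ℕ → ℕ → Bool) :=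
  {x | Models (arrayInterp fun P : L => x P) θ}

theorem mem_event {θ : Sentence L} {x : ℕ → ℕ → Bool} :
    x ∈ event θ ↔ Models (arrayInterp fun P : L => x P) θ :=
  Iff.rfl

theorem isClopen_apply_eq_true (P k : ℕ) : IsClopen {x : ℕ → ℕ → Bool | x P k = true} :=
  (isClopen_discrete {true}).preimage
    (f := fun x : ℕ → ℕ → Bool => x P k) (by fun_prop)

/-- Only finitely many entries of the array matter. Clopenness is what lets probabilities pass to
weak limits. -/
theorem isClopen_realize {n : ℕ} {φ : Form L n} (hφ : φ.IsQF) (v : Fin n → ℕ) :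
    IsClopen {x : ℕ → ℕ → Bool | φ.Realize (arrayInterp fun P : L => x P) v} := by
  induction φ with
  | rel P t => cases t <;> exact isClopen_apply_eq_true _ _
  | bot => exact isClopen_empty
  | neg φ ih => exact (ih hφ v).compl
  | and φ ψ ih ih' => exact (ih hφ.1 v).inter (ih' hφ.2 v)
  | or φ ψ ih ih' => exact (ih hφ.1 v).union (ih' hφ.2 v)
  | imp φ ψ ih ih' =>
    have := (ih hφ.1 v).compl.union (ih' hφ.2 v)
    convert this using 1
    ext x
    exact imp_iff_not_or
  | ex φ => exact hφ.elim
  | all φ => exact hφ.elim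

theorem isClopen_event {θ : Sentence L} (hθ : θ.IsQF) : IsClopen (event θ) :=
  isClopen_realize hθ Fin.elim0

theorem measurableSet_realize {n : ℕ} (φ : Form L n) :
    ∀ v : Fin n → ℕ,
      MeasurableSet {x : ℕ → ℕ → Bool | φ.Realize (arrayInterp fun P : L => x P) v} := by
  induction φ with
  | rel P t => intro v; cases t <;> exact (isClopen_apply_eq_true _ _).isOpen.measurableSet
  | bot => exact fun _ => MeasurableSet.empty
  | neg φ ih => exact fun v => (ih v).compl
  | and φ ψ ih ih' => exact fun v => (ih v).inter (ih' v)
  | or φ ψ ih ih' => exact fun v => (ih v).union (ih' v)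
  | imp φ ψ ih ih' =>
    intro v
    have := (ih v).compl.union (ih' v)
    convert this using 1
    ext x
    exact imp_iff_not_or
  | ex φ ih =>
    intro v
    have := MeasurableSet.iUnion fun d : ℕ => ih (Fin.snoc v d)
    convert this using 1
    ext x
    simp only [Set.mem_iUnion]
    rfl
  | all φ ih =>
    intro v
    have := MeasurableSet.iInter fun d : ℕ => ih (Fin.snoc v d)
    convert this using 1
    ext x
    simp only [Set.mem_iInter]
    rfl

theorem measurableSet_event (θ : Sentence L) : MeasurableSet (event θ) :=
  measurableSet_realize θ Fin.elim0

/-- Every element of the domain is named by a constant, so (P3) is continuity of the measure from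
below. -/
theorem isProbabilityFunction_measure (μ : Measure (ℕ → ℕ → Bool)) [IsProbabilityMeasure μ] :
    IsProbabilityFunction fun θ : Sentence L => μ.real (event θ) where
  mem_Icc θ := ⟨measureReal_nonneg, measureReal_le_one⟩
  valid θ hθ := by
    have : event θ = Set.univ := Set.eq_univ_of_forall fun x => hθ _
    simp [this]
  add θ φ h := measureReal_union (Set.disjoint_left.2 fun x hx hx' => h _ hx hx')
    (measurableSet_event φ)
  ex ψ := by
    have h1 : event ψ.ex = ⋃ n : ℕ,
        event (Form.disj ((List.range n).map fun j => ψ.inst j)) := by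
      ext x
      rw [mem_event, models_ex, Set.mem_iUnion]
      simp only [mem_event, Models, Form.realize_disj, List.mem_map, List.mem_range]
      constructor
      · rintro ⟨d, hd⟩
        exact ⟨Nat.succ d, _, ⟨d, Nat.lt_succ_self d, rfl⟩, (models_inst _ ψ d).2 hd⟩
      · rintro ⟨n, _, ⟨j, -, rfl⟩, h⟩
        exact ⟨j, (models_inst _ ψ j).1 h⟩
    have hmono : Monotone fun n : ℕ =>
        event (Form.disj ((List.range n).map fun j => ψ.inst j)) := by
      intro m n hmn x hx
      obtain ⟨φ, hφ, hx⟩ := (Form.realize_disj _ _ _).1 hx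
      obtain ⟨j, hj, rfl⟩ := List.mem_map.1 hφ
      refine (Form.realize_disj _ _ _).2 ⟨_, List.mem_map.2 ⟨j, ?_, rfl⟩, hx⟩
      rw [List.mem_range] at hj ⊢
      omega
    rw [h1]
    exact (ENNReal.tendsto_toReal (measure_ne_top _ _)).comp
      (tendsto_measure_iUnion_atTop hmono)

/-- Rearrangement of the rows and columns of an array. -/
def permArray (σ τ : Equiv.Perm ℕ) (x : ℕ → ℕ → Bool) : ℕ → ℕ → Bool :=
  fun P k => x (σ P) (τ k)

theorem continuous_permArray (σ τ : Equiv.Perm ℕ) : Continuous (permArray σ τ) := by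
  unfold permArray
  fun_prop

/-- The law of a random array is invariant under rearrangements of the rows and of the
columns. -/
def RowColumnExchangeable (μ : Measure (ℕ → ℕ → Bool)) : Prop :=
  ∀ σ τ : Equiv.Perm ℕ, μ.map (permArray σ τ) = μ

/-- Disjoint subarrays of a random array are independent. -/
def Dissociated (μ : Measure (ℕ → ℕ → Bool)) : Prop :=
  ∀ L : Finset ℕ, WeakIrrelevance fun θ : Sentence L => μ.real (event θ)

theorem RowColumnExchangeable.constantExchangeable {μ : Measure (ℕ → ℕ → Bool)}
    (hμ : RowColumnExchangeable μ) :
    ConstantExchangeable fun θ : Sentence L => μ.real (event θ) := by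
  intro σ φ
  have : event (φ.map id σ) = permArray 1 σ ⁻¹' event φ := by
    ext x
    exact models_arrayInterp_map _ id σ φ
  change μ.real (event (φ.map id σ)) = μ.real (event φ)
  conv_rhs => rw [← hμ 1 σ]
  rw [map_measureReal_apply (continuous_permArray 1 σ).measurable (measurableSet_event φ), this]

theorem RowColumnExchangeable.predicateExchangeable {μ : Measure (ℕ → ℕ → Bool)}
    (hμ : RowColumnExchangeable μ) :
    PredicateExchangeable fun θ : Sentence L => μ.real (event θ) := by
  classical
  intro σ φ
  -- The permutation of `L` is extended by the identity to all predicates.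
  let σ' : Equiv.Perm ℕ := σ.ofSubtype
  have : event (φ.map σ id) = permArray σ' 1 ⁻¹' event φ := by
    ext x
    refine (models_arrayInterp_map _ σ 1 φ).trans ?_
    have h : (fun (P : L) k => x (σ P) (k : ℕ)) = fun P : L => permArray σ' 1 x P := by
      funext P k
      simp [permArray, σ']
    exact iff_of_eq (congrArg (fun y => Models (arrayInterp y) φ) h)
  change μ.real (event (φ.map σ id)) = μ.real (event φ)
  conv_rhs => rw [← hμ σ' 1]
  rw [map_measureReal_apply (continuous_permArray σ' 1).measurable (measurableSet_event φ), this]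

theorem event_incl {L' : Finset ℕ} (h : L' ⊆ L) (φ : Sentence L') : event (φ.incl h) = event φ := by
  ext x
  exact models_arrayInterp_map _ (fun P : L' => (⟨P.1, h P.2⟩ : L)) 1 φ

theorem uliWith_measure {μ : Measure (ℕ → ℕ → Bool)} [IsProbabilityMeasure μ]
    (h : RowColumnExchangeable μ) (h' : Dissociated μ) :
    ULiWith (fun _ => WeakIrrelevance) fun θ : Sentence L => μ.real (event θ) :=
  ⟨fun _ θ => μ.real (event θ), fun L' => ⟨isProbabilityFunction_measure μ,
    h.constantExchangeable, h.predicateExchangeable, h' L'⟩,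
    fun _ _ h φ => congrArg μ.real (event_incl h φ), rfl⟩

/-! ### Weak limits of laws of random arrays -/

theorem tendsto_event {ι : Type*} {l : Filter ι} {μs : ι → ProbabilityMeasure (ℕ → ℕ → Bool)}
    {μ : ProbabilityMeasure (ℕ → ℕ → Bool)} (h : Tendsto μs l (𝓝 μ)) {θ : Sentence L}
    (hθ : θ.IsQF) :
    Tendsto (fun i => (μs i : Measure (ℕ → ℕ → Bool)).real (event θ)) l
      (𝓝 ((μ : Measure (ℕ → ℕ → Bool)).real (event θ))) :=
  (NNReal.continuous_coe.tendsto _).comp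
    (ProbabilityMeasure.tendsto_measure_of_isClopen_of_tendsto h (isClopen_event hθ))

theorem RowColumnExchangeable.of_tendsto {ι : Type*} {l : Filter ι} [l.NeBot]
    {μs : ι → ProbabilityMeasure (ℕ → ℕ → Bool)} {μ : ProbabilityMeasure (ℕ → ℕ → Bool)}
    (h : Tendsto μs l (𝓝 μ)) (hμs : ∀ᶠ i in l, RowColumnExchangeable (μs i : Measure _)) :
    RowColumnExchangeable (μ : Measure (ℕ → ℕ → Bool)) := by
  intro σ τ
  have h1 := ProbabilityMeasure.tendsto_map_of_tendsto_of_continuous μs μ h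
    (continuous_permArray σ τ)
  have h2 := tendsto_nhds_unique (h1.congr' ?_) h
  · exact congrArg Subtype.val h2
  · filter_upwards [hμs] with i hi
    exact Subtype.ext (hi σ τ)

theorem Dissociated.of_tendsto {ι : Type*} {l : Filter ι} [l.NeBot]
    {μs : ι → ProbabilityMeasure (ℕ → ℕ → Bool)} {μ : ProbabilityMeasure (ℕ → ℕ → Bool)}
    (h : Tendsto μs l (𝓝 μ)) (hμs : ∀ᶠ i in l, Dissociated (μs i : Measure _)) :
    Dissociated (μ : Measure (ℕ → ℕ → Bool)) := by
  intro L θ φ hθ hφ hc hp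
  refine tendsto_nhds_unique (tendsto_event h (θ := θ.and φ) ⟨hθ, hφ⟩) ?_
  refine ((tendsto_event h hθ).mul (tendsto_event h hφ)).congr' ?_
  filter_upwards [hμs] with i hi
  exact (hi L θ φ hθ hφ hc hp).symm

end Arrays

/-! ### Sampling from a square description -/

section Sampling

variable {N : ℕ}

/-- The array obtained by listing rows and columns of `M`, with repetitions. -/
def sampleArray (M : SquareDescription N) (ω : ℕ ⊕ ℕ → Fin N) : ℕ → ℕ → Bool :=
  fun P k => M (ω (Sum.inl P)) (ω (Sum.inr k))

theorem measurable_sampleArray (M : SquareDescription N) : Measurable (sampleArray M) := by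
  refine measurable_pi_iff.2 fun P => measurable_pi_iff.2 fun k => ?_
  have h : Measurable fun ω : ℕ ⊕ ℕ → Fin N => (ω (Sum.inl P), ω (Sum.inr k)) := by fun_prop
  exact (Measurable.of_discrete (f := fun p : Fin N × Fin N => M p.1 p.2)).comp h

/-- Independent uniformly distributed elements of `Fin N`. -/
noncomputable def uniformSequence (N : ℕ) : Measure (ℕ ⊕ ℕ → Fin N) :=
  Measure.infinitePi fun _ => uniformOn Set.univ

instance [NeZero N] : IsProbabilityMeasure (uniformOn (Set.univ : Set (Fin N))) :=
  isProbabilityMeasure_uniformOn Set.finite_univ Set.univ_nonempty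

instance [NeZero N] : IsProbabilityMeasure (uniformSequence N) := by
  unfold uniformSequence
  infer_instance

/-- The law of the array obtained by sampling rows and columns of `M` independently, uniformly
and with replacement. -/
noncomputable def sampleMeasure (M : SquareDescription N) : Measure (ℕ → ℕ → Bool) :=
  (uniformSequence N).map (sampleArray M)

instance [NeZero N] (M : SquareDescription N) : IsProbabilityMeasure (sampleMeasure M) :=
  Measure.isProbabilityMeasure_map (measurable_sampleArray M).aemeasurable

/-- Permuting rows and columns of the sample permutes the indices of an i.i.d. family. -/
theorem rowColumnExchangeable_sampleMeasure [NeZero N] (M : SquareDescription N) :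
    RowColumnExchangeable (sampleMeasure M) := by
  intro σ τ
  have h1 := Measure.map_infinitePi_infinitePi_of_inj
    (P := fun _ : ℕ ⊕ ℕ => uniformOn (Set.univ : Set (Fin N)))
    (f := Sum.map σ τ) (Sum.map_injective.2 ⟨σ.injective, τ.injective⟩)
  have h2 : permArray σ τ ∘ sampleArray M =
      sampleArray M ∘ fun ω i => ω (Sum.map σ τ i) := rfl
  rw [sampleMeasure, Measure.map_map (continuous_permArray σ τ).measurable
    (measurable_sampleArray M), h2, ← Measure.map_map (measurable_sampleArray M) (by fun_prop)]
  exact congrArg _ h1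

/-- The sentence sees only the draws for the predicates and constants it mentions, which reduces WIP
to independence of disjoint blocks of coordinates. -/
theorem exists_event_eq_preimage (M : SquareDescription N) {L : Finset ℕ} {θ : Sentence L}
    (hθ : θ.IsQF) {S : Finset (ℕ ⊕ ℕ)} (hp : ∀ P ∈ θ.preds, Sum.inl P.1 ∈ S)
    (hc : ∀ k ∈ θ.consts, Sum.inr k ∈ S) :
    ∃ A : Set (S → Fin N), sampleArray M ⁻¹' event θ = (fun ω (i : S) => ω i) ⁻¹' A := by
  refine ⟨(fun ω (i : S) => ω i) '' (sampleArray M ⁻¹' event θ), ?_⟩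
  refine (Set.subset_preimage_image _ _).antisymm ?_
  rintro ω ⟨ω', hω', heq⟩
  refine (models_congr_of_isQF hθ fun P hP k hk => ?_).1 hω'
  have h1 := congrFun heq ⟨_, hp P hP⟩
  have h2 := congrFun heq ⟨_, hc k hk⟩
  simp only at h1 h2
  simp [arrayInterp, sampleArray, h1, h2]

theorem dissociated_sampleMeasure [NeZero N] (M : SquareDescription N) :
    Dissociated (sampleMeasure M) := by
  classical
  intro L θ φ hθ hφ hc hp
  let S (ψ : Sentence L) : Finset (ℕ ⊕ ℕ) :=
    (ψ.finite_preds.toFinset.image Subtype.val).disjSum ψ.finite_consts.toFinset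
  have hS (ψ : Sentence L) (hψ : ψ.IsQF) := exists_event_eq_preimage M hψ (S := S ψ)
    (fun P hP => Finset.inl_mem_disjSum.2 (Finset.mem_image.2 ⟨P, by simpa using hP, rfl⟩))
    (fun k hk => Finset.inr_mem_disjSum.2 (by simpa using hk))
  have hST : Disjoint (S θ) (S φ) := by
    rw [Finset.disjoint_left]
    rintro (P | k) h1 h2
    · simp only [S, Finset.inl_mem_disjSum, Finset.mem_image, Set.Finite.mem_toFinset] at h1 h2
      obtain ⟨P₁, h1, rfl⟩ := h1
      obtain ⟨P₂, h2, h⟩ := h2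
      rw [Subtype.ext h] at h2
      exact Set.disjoint_left.1 hp h1 h2
    · simp only [S, Finset.inr_mem_disjSum, Set.Finite.mem_toFinset] at h1 h2
      exact Set.disjoint_left.1 hc h1 h2
  obtain ⟨A, hA⟩ := hS θ hθ
  obtain ⟨B, hB⟩ := hS φ hφ
  have hind := (iIndepFun_infinitePi
    (P := fun _ : ℕ ⊕ ℕ => uniformOn (Set.univ : Set (Fin N)))
    (X := fun _ ω => ω) fun _ => measurable_id).indepFun_finset (S θ) (S φ) hST
    fun i => measurable_pi_apply i
  have key := hind.measure_inter_preimage_eq_mul A B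
    (Set.toFinite A).measurableSet (Set.toFinite B).measurableSet
  rw [← hA, ← hB] at key
  have hand : event (θ.and φ) = event θ ∩ event φ := rfl
  simp only [sampleMeasure]
  rw [map_measureReal_apply (measurable_sampleArray M) (measurableSet_event _),
    map_measureReal_apply (measurable_sampleArray M) (measurableSet_event _),
    map_measureReal_apply (measurable_sampleArray M) (measurableSet_event _), hand,
    Set.preimage_inter, Measure.real, uniformSequence, key, ENNReal.toReal_mul]
  rfl

theorem wVec_eq_prod {L : Finset ℕ} (x : Atom L → ℝ) {n : ℕ} (h : Fin n → Atom L) :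
    wVec x h = ∏ j, x (h j) := by
  classical
  rw [wVec, ← Finset.prod_fiberwise (s := Finset.univ) (g := h) (f := fun j => x (h j))]
  refine Finset.prod_congr rfl fun α _ => ?_
  rw [Finset.prod_congr rfl fun j hj => by rw [(Finset.mem_filter.1 hj).2], Finset.prod_const]

/-- For fixed rows, the product of the column counts is the number of `n`-tuples of columns,
repetitions allowed, that show the pattern `h`. -/
theorem nabla_eq_sum (M : SquareDescription N) {L : Finset ℕ} {n : ℕ} (h : Fin n → Atom L) :
    nabla M h = (1 / (N : ℝ) ^ L.card * (1 / (N : ℝ) ^ n)) *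
      ∑ a : (L → Fin N) × (Fin n → Fin N),
        if ∀ j P, M (a.1 P) (a.2 j) = h j P then (1 : ℝ) else 0 := by
  classical
  rw [nabla, Fintype.sum_prod_type, Finset.mul_sum]
  refine Finset.sum_congr rfl fun e _ => ?_
  rw [mul_assoc, wVec_eq_prod, Finset.sum_boole]
  congr 1
  simp only [rowFreq]
  rw [Finset.prod_div_distrib, Finset.prod_const, Finset.card_univ, Fintype.card_fin,
    one_div_mul_eq_div, ← Nat.cast_prod, ← Fintype.card_piFinset]
  congr 3
  ext j
  simp [Fintype.mem_piFinset]

theorem measureReal_infinitePi_uniformOn [NeZero N] {α : Type*} [Fintype α] [DecidableEq α]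
    (A : Set (α → Fin N)) [DecidablePred (· ∈ A)] :
    (Measure.infinitePi fun _ : α => uniformOn (Set.univ : Set (Fin N))).real A =
      1 / (N : ℝ) ^ Fintype.card α * ∑ a : α → Fin N, if a ∈ A then (1 : ℝ) else 0 := by
  conv_lhs => rw [← Set.coe_toFinset A, ← sum_measureReal_singleton]
  rw [Finset.sum_congr rfl (g := fun _ => 1 / (N : ℝ) ^ Fintype.card α)]
  · rw [Finset.sum_const, nsmul_eq_mul, mul_comm, Finset.sum_boole,
      Set.filter_mem_univ_eq_toFinset]
  · intro a _
    rw [Measure.real, Measure.infinitePi_singleton_of_fintype, ENNReal.toReal_prod]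
    simp [uniformOn_univ]

/-- Only the coordinates in the image of the injection of `L ⊕ Fin n` matter, and their joint law is
uniform on a finite set. -/
theorem sampleMeasure_stateDescription [NeZero N] (M : SquareDescription N) {L : Finset ℕ}
    {n : ℕ} (h : Fin n → Atom L) (c : Fin n ↪ ℕ) :
    (sampleMeasure M).real (event (stateDescription h c)) = nabla M h := by
  classical
  have hinj : Function.Injective (Sum.map Subtype.val c : L ⊕ Fin n → ℕ ⊕ ℕ) :=
    Sum.map_injective.2 ⟨Subtype.val_injective, c.injective⟩
  have h1 := Measure.map_infinitePi_infinitePi_of_inj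
    (P := fun _ : ℕ ⊕ ℕ => uniformOn (Set.univ : Set (Fin N))) hinj
  let A : Set (L ⊕ Fin n → Fin N) :=
    {a | ∀ j P, M (a (Sum.inl P)) (a (Sum.inr j)) = h j P}
  have h2 : sampleArray M ⁻¹' event (stateDescription h c) =
      (fun ω i => ω (Sum.map Subtype.val c i)) ⁻¹' A := by
    ext ω
    simp only [Set.mem_preimage, mem_event, models_stateDescription]
    exact forall₂_congr fun j P => Bool.eq_iff_iff.symm
  rw [sampleMeasure, map_measureReal_apply (measurable_sampleArray M) (measurableSet_event _), h2,
    ← map_measureReal_apply (by fun_prop) (Set.toFinite A).measurableSet, uniformSequence, h1,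
    measureReal_infinitePi_uniformOn, nabla_eq_sum, Fintype.card_sum, Fintype.card_coe,
    Fintype.card_fin, pow_add, one_div_mul_one_div]
  congr 1
  exact Fintype.sum_equiv (Equiv.sumArrowEquivProdArrow _ _ _) _ _ fun a => rfl

end Sampling

/-! ### Standard parts -/

section StandardPart

variable {ι : Type*} {U : Ultrafilter ι}

/-- The embedding of the reals in an ultrapower. -/
def germConst (U : Ultrafilter ι) : ℝ →+*o (U : Filter ι).Germ ℝ where
  toFun x := (Germ.const x : (U : Filter ι).Germ ℝ)
  map_zero' := rfl
  map_one' := rfl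
  map_add' _ _ := rfl
  map_mul' _ _ := rfl
  monotone' _ _ h := Germ.const_le h

theorem stdPart_germ_eq {f : ι → ℝ} {r : ℝ} (h : Tendsto f U (𝓝 r)) :
    ArchimedeanClass.stdPart (f : (U : Filter ι).Germ ℝ) = r :=
  ArchimedeanClass.stdPart_eq (germConst U)
    (fun _ hs => Germ.coe_le.2 ((h.eventually_const_lt hs).mono fun _ => le_of_lt))
    (fun _ hs => Germ.coe_le.2 ((h.eventually_lt_const hs).mono fun _ => le_of_lt))

theorem tendsto_atTop_of_const_lt {f : ι → ℕ}
    (h : ∀ n : ℕ, (Germ.const n : (U : Filter ι).Germ ℕ) < (f : (U : Filter ι).Germ ℕ)) :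
    Tendsto f U atTop :=
  tendsto_atTop.2 fun n => (Germ.coe_lt.1 (h n)).mono fun _ => le_of_lt

end StandardPart

/-- The law of a random array, row and column exchangeable and dissociated, that represents the
functions `°∇` in all languages. -/
theorem exists_measure_isStdNabla {ι : Type*} {U : Ultrafilter ι} {ν : (U : Filter ι).Germ ℕ}
    (hν : ∀ n : ℕ, (Germ.const n : (U : Filter ι).Germ ℕ) < ν) (Υ : HyperDescription U ν) :
    ∃ μ : ProbabilityMeasure (ℕ → ℕ → Bool), RowColumnExchangeable (μ : Measure _) ∧
      Dissociated (μ : Measure _) ∧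
      ∀ L : Finset ℕ, IsStdNabla Υ fun θ : Sentence L => (μ : Measure _).real (event θ) := by
  obtain ⟨Υ, rfl⟩ := Υ
  induction Υ using Germ.inductionOn with
  | _ g =>
  have hpos : ∀ᶠ i in (U : Filter ι), (g i).1 ≠ 0 := by
    filter_upwards [(tendsto_atTop_of_const_lt hν).eventually_ge_atTop 1] with i hi
    exact (Nat.lt_of_lt_of_le one_pos hi).ne'
  let μs (i : ι) : ProbabilityMeasure (ℕ → ℕ → Bool) :=
    if h : (g i).1 ≠ 0 then
      have : NeZero (g i).1 := ⟨h⟩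
      ⟨sampleMeasure (g i).2, inferInstance⟩
    else ⟨Measure.dirac fun _ _ => false, inferInstance⟩
  have hμs {p : ι → Measure (ℕ → ℕ → Bool) → Prop}
      (h : ∀ i, (g i).1 ≠ 0 → p i (sampleMeasure (g i).2)) :
      ∀ᶠ i in (U : Filter ι), p i (μs i : Measure _) := by
    filter_upwards [hpos] with i hi
    have : μs i = ⟨sampleMeasure (g i).2, _⟩ := dif_pos hi
    rw [this]
    exact h i hi
  -- By compactness of the space of probability measures, the image ultrafilter converges.
  obtain ⟨μ, -, hμ⟩ := isCompact_univ.ultrafilter_le_nhds (U.map μs) (by simp)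
  have hlim : Tendsto μs U (𝓝 μ) := hμ
  refine ⟨μ, .of_tendsto hlim (hμs fun i hi => ?_), .of_tendsto hlim (hμs fun i hi => ?_),
    fun L => ⟨isProbabilityFunction_measure _, fun n h c => ?_⟩⟩
  · have : NeZero (g i).1 := ⟨hi⟩
    exact rowColumnExchangeable_sampleMeasure _
  · have : NeZero (g i).1 := ⟨hi⟩
    exact dissociated_sampleMeasure _
  · refine (stdPart_germ_eq ?_).symm
    refine (tendsto_event hlim (isQF_stateDescription h c)).congr' ?_
    refine hμs (p := fun i m => m.real (event (stateDescription h c)) = nabla (g i).2 h)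
      fun i hi => ?_
    have : NeZero (g i).1 := ⟨hi⟩
    exact sampleMeasure_stateDescription _ h c

theorem IsStdNabla.unique {ι : Type*} {U : Ultrafilter ι} {ν : (U : Filter ι).Germ ℕ}
    {Υ : HyperDescription U ν} {L : Finset ℕ} {w w' : Sentence L → ℝ} (h : IsStdNabla Υ w)
    (h' : IsStdNabla Υ w') : w = w' :=
  h.1.eq_of_stateDescription h'.1 fun n d c => (h.2 n d c).trans (h'.2 n d c).symm

/-! ### Choosing typical points -/

/-- If countably many functions with values in `[0, 1]` on finite probability spaces have means
tending to `0`, they tend to `0` simultaneously along some sequence of points. -/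
theorem exists_seq_tendsto_zero {Ω : ℕ → Type} [∀ N, Fintype (Ω N)] [∀ N, Nonempty (Ω N)]
    {T : Type} [Countable T] {p : ∀ N, Ω N → ℝ}
    (hp : ∀ᶠ N in atTop, (∀ x, 0 ≤ p N x) ∧ ∑ x, p N x = 1) {g : T → ∀ N, Ω N → ℝ}
    (hg : ∀ t N x, g t N x ∈ Set.Icc (0 : ℝ) 1)
    (h : ∀ t, Tendsto (fun N => ∑ x, p N x * g t N x) atTop (𝓝 0)) :
    ∃ x : ∀ N, Ω N, ∀ t, Tendsto (fun N => g t N (x N)) atTop (𝓝 0) := by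
  have := Encodable.ofCountable T
  let a (t : T) : ℝ := (1 / 2) ^ Encodable.encode t
  have ha : Summable a := summable_geometric_two_encode
  have ha0 (t : T) : 0 < a t := by positivity
  have hS (N : ℕ) (x : Ω N) : Summable fun t => a t * g t N x :=
    ha.of_nonneg_of_le (fun t => mul_nonneg (ha0 t).le (hg t N x).1)
      fun t => mul_le_of_le_one_right (ha0 t).le (hg t N x).2
  let S (N : ℕ) (x : Ω N) : ℝ := ∑' t, a t * g t N x
  -- The mean of the weighted sum `S N` tends to 0 by dominated convergence, with the summable
  -- weights `a` as bound.
  have hE : Tendsto (fun N => ∑' t, a t * ∑ x, p N x * g t N x) atTop (𝓝 0) := by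
    have := tendsto_tsum_of_dominated_convergence (𝓕 := atTop) (bound := a)
      (f := fun N t => a t * ∑ x, p N x * g t N x) (g := fun _ => (0 : ℝ)) ha
      (fun t => by simpa using (h t).const_mul (a t)) ?_
    · simpa using this
    · filter_upwards [hp] with N hN t
      have h0 : 0 ≤ ∑ x, p N x * g t N x :=
        Finset.sum_nonneg fun x _ => mul_nonneg (hN.1 x) (hg t N x).1
      have h1 : ∑ x, p N x * g t N x ≤ 1 := by
        rw [← hN.2]
        exact Finset.sum_le_sum fun x _ => mul_le_of_le_one_right (hN.1 x) (hg t N x).2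
      rw [Real.norm_of_nonneg (mul_nonneg (ha0 t).le h0)]
      exact mul_le_of_le_one_right (ha0 t).le h1
  -- A minimizer of `S N` has value at most the mean, and `S N` bounds each `a t * g t N` since all
  -- terms are nonnegative.
  choose x hx using fun N => Finite.exists_min (S N)
  refine ⟨x, fun t => ?_⟩
  have hle : ∀ᶠ N in atTop, g t N (x N) ≤ (a t)⁻¹ * ∑' t, a t * ∑ x, p N x * g t N x := by
    filter_upwards [hp] with N hN
    have h1 : ∑' t, a t * ∑ x, p N x * g t N x = ∑ y, p N y * S N y := by
      simp only [Finset.mul_sum, S, ← tsum_mul_left]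
      rw [Summable.tsum_finsetSum fun y _ => ?_]
      · simp only [mul_left_comm]
      · simpa only [mul_left_comm] using (hS N y).mul_left (p N y)
    have h2 : S N (x N) ≤ ∑ y, p N y * S N y := by
      rw [← one_mul (S N (x N)), ← hN.2, Finset.sum_mul]
      exact Finset.sum_le_sum fun y _ => mul_le_mul_of_nonneg_left (hx N y) (hN.1 y)
    have h3 : a t * g t N (x N) ≤ S N (x N) :=
      (hS N (x N)).le_tsum t fun t _ => mul_nonneg (ha0 t).le (hg t N _).1
    rw [h1, le_inv_mul_iff₀ (ha0 t)]
    exact h3.trans h2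
  have hlim := hE.const_mul (a t)⁻¹
  rw [mul_zero] at hlim
  exact tendsto_of_tendsto_of_tendsto_of_le_of_le' tendsto_const_nhds hlim
    (.of_forall fun N => (hg t N _).1) hle

theorem tendsto_descFactorial_div_pow (k : ℕ) :
    Tendsto (fun N : ℕ => (N.descFactorial k : ℝ) / (N : ℝ) ^ k) atTop (𝓝 1) := by
  refine (Asymptotics.isEquivalent_iff_tendsto_one ?_).1 (isEquivalent_descFactorial k)
  filter_upwards [eventually_ge_atTop 1] with N hN
  positivity

/-! ### The distribution of a corner of a random array -/

section Corner

variable {N : ℕ} {w : Sentence (Finset.range N) → ℝ}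

/-- Square descriptions of size `N` as lists of `N` atoms. -/
def squareEquiv (N : ℕ) : SquareDescription N ≃ (Fin N → Atom (Finset.range N)) where
  toFun M j P := M ⟨P.1, Finset.mem_range.1 P.2⟩ j
  invFun h i j := h j ⟨i.1, Finset.mem_range.2 i.2⟩
  left_inv _ := rfl
  right_inv _ := rfl

/-- The probability of a square description of the first `N` constants. -/
noncomputable def cornerWeight (w : Sentence (Finset.range N) → ℝ) (M : SquareDescription N) : ℝ :=
  w (stateDescription (squareEquiv N M) Fin.valEmbedding)

/-- The structure given by a square description; predicates do not hold of constants outside it. -/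
def squareInterp (M : SquareDescription N) : Interp (Finset.range N) :=
  arrayInterp fun P k => if hk : k < N then M ⟨P.1, Finset.mem_range.1 P.2⟩ ⟨k, hk⟩ else false

open Classical in
theorem sum_cornerWeight_mul (hw : IsProbabilityFunction w) {θ : Sentence (Finset.range N)}
    (hθ : θ.IsQF) (hN : ∀ k ∈ θ.consts, k < N) :
    ∑ M, cornerWeight w M * (if Models (squareInterp M) θ then 1 else 0) = w θ := by
  rw [hw.apply_eq_sum hθ hN]
  refine Fintype.sum_equiv (squareEquiv N) _ _ fun M => ?_
  rw [mul_ite, mul_one, mul_zero]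
  rfl

theorem cornerWeight_nonneg (hw : IsProbabilityFunction w) (M : SquareDescription N) :
    0 ≤ cornerWeight w M :=
  (hw.mem_Icc _).1

theorem sum_cornerWeight (hw : IsProbabilityFunction w) : ∑ M, cornerWeight w M = 1 := by
  classical
  have h1 := sum_cornerWeight_mul hw (θ := Form.bot.neg) trivial fun k hk => hk.elim
  rw [hw.valid Form.bot.neg fun M h => h] at h1
  rw [← h1]
  refine Finset.sum_congr rfl fun M _ => ?_
  rw [if_pos, mul_one]
  exact fun h => h

variable {L : Finset ℕ} {n : ℕ}

/-- The sentence saying that the entries of the array in the rows `a.1` and the columns `a.2` are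
given by `h`. -/
def sampledSentence (h : Fin n → Atom L) (a : (L → Fin N) × (Fin n → Fin N)) :
    Sentence (Finset.range N) :=
  (stateDescription h Fin.valEmbedding).map
    (fun P => ⟨a.1 P, Finset.mem_range.2 (a.1 P).2⟩)
    fun k => if hk : k < n then (a.2 ⟨k, hk⟩ : ℕ) else 0

theorem models_sampledSentence (M : Interp (Finset.range N)) (h : Fin n → Atom L)
    (a : (L → Fin N) × (Fin n → Fin N)) :
    Models M (sampledSentence h a) ↔ ∀ j P,
      (M.pred ⟨a.1 P, Finset.mem_range.2 (a.1 P).2⟩ (M.const (a.2 j)) ↔ h j P = true) := by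
  rw [sampledSentence, models_map, models_stateDescription]
  simp [Interp.comap]

theorem models_squareInterp_sampledSentence (M : SquareDescription N) (h : Fin n → Atom L)
    (a : (L → Fin N) × (Fin n → Fin N)) :
    Models (squareInterp M) (sampledSentence h a) ↔ ∀ j P, M (a.1 P) (a.2 j) = h j P := by
  rw [models_sampledSentence]
  refine forall₂_congr fun j P => ?_
  rw [Bool.eq_iff_iff]
  simp [squareInterp, arrayInterp]

theorem isQF_sampledSentence (h : Fin n → Atom L) (a : (L → Fin N) × (Fin n → Fin N)) :
    (sampledSentence h a).IsQF :=
  Form.isQF_map _ _ (isQF_stateDescription _ _)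

theorem consts_sampledSentence (h : Fin n → Atom L) (a : (L → Fin N) × (Fin n → Fin N)) :
    ∀ k ∈ (sampledSentence h a).consts, ∃ j, k = a.2 j := by
  intro k hk
  rw [sampledSentence, Form.consts_map] at hk
  obtain ⟨k, hk, rfl⟩ := hk
  obtain ⟨j, rfl⟩ := consts_stateDescription_subset _ _ hk
  exact ⟨j, by simp⟩

theorem preds_sampledSentence (h : Fin n → Atom L) (a : (L → Fin N) × (Fin n → Fin N)) :
    ∀ P ∈ (sampledSentence h a).preds, ∃ Q, P.1 = a.1 Q := by
  intro P hP
  rw [sampledSentence, Form.preds_map] at hP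
  obtain ⟨Q, -, rfl⟩ := hP
  exact ⟨Q, rfl⟩

/-- Injective choices of rows and columns extend to permutations of the predicates and of the
constants, so Px and Ex apply. -/
theorem apply_sampledSentence (hw : IsProbabilityFunction w) (hc : ConstantExchangeable w)
    (hp : PredicateExchangeable w) (hL : L ⊆ Finset.range N) (h : Fin n → Atom L)
    (c : Fin n ↪ ℕ) {a : (L → Fin N) × (Fin n → Fin N)} (h1 : Function.Injective a.1)
    (h2 : Function.Injective a.2) :
    w (sampledSentence h a) = w ((stateDescription h c).incl hL) := by
  obtain ⟨σ, hσ⟩ := Equiv.Perm.exists_extending_pair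
    (fun P : L => (⟨P.1, hL P.2⟩ : Finset.range N))
    (fun P : L => (⟨a.1 P, Finset.mem_range.2 (a.1 P).2⟩ : Finset.range N))
    (fun P Q hPQ => Subtype.ext (Subtype.mk.inj hPQ))
    (fun P Q hPQ => h1 (Fin.ext (Subtype.ext_iff.1 hPQ)))
  obtain ⟨τ, hτ⟩ := Equiv.Perm.exists_extending_pair c (fun j => (a.2 j : ℕ)) c.injective
    (Fin.val_injective.comp h2)
  rw [← hp σ ((stateDescription h c).incl hL),
    ← hc τ (((stateDescription h c).incl hL).map σ id)]
  refine hw.congr fun M => ?_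
  rw [models_sampledSentence, models_map, models_map, Sentence.incl, models_map,
    models_stateDescription]
  simp [Interp.comap, hσ, hτ]

theorem apply_sampledSentence_and (hw : WeakIrrelevance w) (h : Fin n → Atom L)
    {a b : (L → Fin N) × (Fin n → Fin N)} (h1 : Function.Injective (Sum.elim a.1 b.1))
    (h2 : Function.Injective (Sum.elim a.2 b.2)) :
    w ((sampledSentence h a).and (sampledSentence h b)) =
      w (sampledSentence h a) * w (sampledSentence h b) := by
  refine hw _ _ (isQF_sampledSentence h a) (isQF_sampledSentence h b) ?_ ?_
  · refine Set.disjoint_left.2 fun k hk hk' => ?_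
    obtain ⟨i, hi⟩ := consts_sampledSentence h a k hk
    obtain ⟨j, hj⟩ := consts_sampledSentence h b k hk'
    have := @h2 (Sum.inl i) (Sum.inr j) (Fin.ext (hi.symm.trans hj))
    simp at this
  · refine Set.disjoint_left.2 fun P hP hP' => ?_
    obtain ⟨i, hi⟩ := preds_sampledSentence h a P hP
    obtain ⟨j, hj⟩ := preds_sampledSentence h b P hP'
    have := @h1 (Sum.inl i) (Sum.inr j) (Fin.ext (hi.symm.trans hj))
    simp at this

open Classical in
-- A pair of injective choices with disjoint images is the same as an embedding of the doubled index
-- set, for rows and for columns.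
theorem descFactorial_mul_le_card (L : Finset ℕ) (N n : ℕ) :
    N.descFactorial (2 * L.card) * N.descFactorial (2 * n) ≤
      (Finset.univ.filter fun ab :
        ((L → Fin N) × (Fin n → Fin N)) × ((L → Fin N) × (Fin n → Fin N)) =>
        Function.Injective (Sum.elim ab.1.1 ab.2.1) ∧
          Function.Injective (Sum.elim ab.1.2 ab.2.2)).card := by
  have h1 : N.descFactorial (2 * L.card) * N.descFactorial (2 * n) =
      (Finset.univ : Finset ((L ⊕ L ↪ Fin N) × (Fin n ⊕ Fin n ↪ Fin N))).card := by
    simp [Fintype.card_embedding_eq, two_mul]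
  rw [h1]
  refine Finset.card_le_card_of_injOn
    (fun f => ((f.1 ∘ Sum.inl, f.2 ∘ Sum.inl), (f.1 ∘ Sum.inr, f.2 ∘ Sum.inr))) ?_ ?_
  · rintro ⟨f, g⟩ -
    simp only [Finset.coe_filter, Finset.mem_univ, true_and, Set.mem_ofPred_eq,
      Sum.elim_comp_inl_inr]
    exact ⟨f.injective, g.injective⟩
  · rintro ⟨f, g⟩ - ⟨f', g'⟩ - hfg
    simp only [Prod.mk.injEq] at hfg
    obtain ⟨⟨h1, h2⟩, h3, h4⟩ := hfg
    refine Prod.ext (DFunLike.coe_injective ?_) (DFunLike.coe_injective ?_)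
    · rw [← Sum.elim_comp_inl_inr (⇑f), ← Sum.elim_comp_inl_inr (⇑f'), h1, h3]
    · rw [← Sum.elim_comp_inl_inr (⇑g), ← Sum.elim_comp_inl_inr (⇑g'), h2, h4]

theorem nabla_mem_Icc (M : SquareDescription N) (h : Fin n → Atom L) :
    nabla M h ∈ Set.Icc (0 : ℝ) 1 := by
  classical
  rw [nabla_eq_sum, Finset.sum_boole]
  refine ⟨by positivity, ?_⟩
  have h1 : ((Finset.univ.filter fun a : (L → Fin N) × (Fin n → Fin N) =>
      ∀ j P, M (a.1 P) (a.2 j) = h j P).card : ℝ) ≤ (N : ℝ) ^ L.card * (N : ℝ) ^ n := by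
    have := Finset.card_filter_le (Finset.univ : Finset ((L → Fin N) × (Fin n → Fin N)))
      fun a => ∀ j P, M (a.1 P) (a.2 j) = h j P
    rw [Finset.card_univ, Fintype.card_prod] at this
    simp only [Fintype.card_fun, Fintype.card_fin, Fintype.card_coe] at this
    exact_mod_cast this
  rw [one_div_mul_one_div, one_div_mul_eq_div]
  exact div_le_one_of_le₀ h1 (by positivity)

/-- The second moment bound: a random corner of a dissociated array samples correctly. -/
theorem sum_cornerWeight_mul_sq_le (hN : 0 < N) (hw : IsProbabilityFunction w)
    (hc : ConstantExchangeable w)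
    (hp : PredicateExchangeable w) (hwip : WeakIrrelevance w) (hL : L ⊆ Finset.range N)
    (h : Fin n → Atom L) (c : Fin n ↪ ℕ) :
    ∑ M, cornerWeight w M * (nabla M h - w ((stateDescription h c).incl hL)) ^ 2 ≤
      1 - N.descFactorial (2 * L.card) / (N : ℝ) ^ (2 * L.card) *
        (N.descFactorial (2 * n) / (N : ℝ) ^ (2 * n)) := by
  classical
  set v := w ((stateDescription h c).incl hL) with hv
  have hv01 : v ∈ Set.Icc (0 : ℝ) 1 := hw.mem_Icc _
  let A : Type := (L → Fin N) × (Fin n → Fin N)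
  let X (a : A) (M : SquareDescription N) : ℝ :=
    if Models (squareInterp M) (sampledSentence h a) then 1 else 0
  let good (ab : A × A) : Prop := Function.Injective (Sum.elim ab.1.1 ab.2.1) ∧
    Function.Injective (Sum.elim ab.1.2 ab.2.2)
  -- The uniform weight of one choice of rows and columns; the mean square error becomes `κ ^ 2`
  -- times a sum over pairs of choices.
  let κ : ℝ := 1 / (N : ℝ) ^ L.card * (1 / (N : ℝ) ^ n)
  have hcard : κ * Fintype.card A = 1 := by
    simp only [A, κ, Fintype.card_prod, Fintype.card_fun, Fintype.card_fin, Fintype.card_coe]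
    push_cast
    field_simp
  have hnabla (M : SquareDescription N) : nabla M h - v = κ * ∑ a : A, (X a M - v) := by
    rw [nabla_eq_sum, Finset.sum_sub_distrib, Finset.sum_const, Finset.card_univ, nsmul_eq_mul,
      mul_sub, ← mul_assoc κ, hcard, one_mul]
    congr 2
    refine Finset.sum_congr rfl fun a _ => ?_
    simp only [X, models_squareInterp_sampledSentence]
  have hsq (M : SquareDescription N) :
      (nabla M h - v) ^ 2 = κ ^ 2 * ∑ ab : A × A, (X ab.1 M - v) * (X ab.2 M - v) := by
    rw [hnabla, mul_pow, sq (∑ a : A, (X a M - v)), Finset.sum_mul_sum, ← Fintype.sum_prod_type']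
  have hlt (a : A) : ∀ k ∈ (sampledSentence h a).consts, k < N := by
    intro k hk
    obtain ⟨j, rfl⟩ := consts_sampledSentence h a k hk
    exact (a.2 j).2
  have hX (a : A) : ∑ M, cornerWeight w M * X a M = w (sampledSentence h a) :=
    sum_cornerWeight_mul hw (isQF_sampledSentence h a) (hlt a)
  have hXX (a b : A) : ∑ M, cornerWeight w M * (X a M * X b M) =
      w ((sampledSentence h a).and (sampledSentence h b)) := by
    rw [← sum_cornerWeight_mul hw (θ := (sampledSentence h a).and (sampledSentence h b)) ⟨isQF_sampledSentence h a, isQF_sampledSentence h b⟩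
      fun k hk => hk.elim (hlt a k) (hlt b k)]
    refine Finset.sum_congr rfl fun M _ => ?_
    congr 1
    have : Models (squareInterp M) ((sampledSentence h a).and (sampledSentence h b)) ↔
      Models (squareInterp M) (sampledSentence h a) ∧
        Models (squareInterp M) (sampledSentence h b) := Iff.rfl
    simp only [X, this, ite_and, mul_ite, mul_one, mul_zero]
    split_ifs <;> rfl
  -- Disjoint choices: both means equal `v` and WIP factors the mixed moment, so the covariance
  -- vanishes.
  have hgood (ab : A × A) (hab : good ab) :
      ∑ M, cornerWeight w M * ((X ab.1 M - v) * (X ab.2 M - v)) = 0 := by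
    have e1 : w (sampledSentence h ab.1) = v := apply_sampledSentence hw hc hp hL h c
      (hab.1.comp Sum.inl_injective) (hab.2.comp Sum.inl_injective)
    have e2 : w (sampledSentence h ab.2) = v := apply_sampledSentence hw hc hp hL h c
      (hab.1.comp Sum.inr_injective) (hab.2.comp Sum.inr_injective)
    have e3 := apply_sampledSentence_and hwip h hab.1 hab.2
    have expand (M : SquareDescription N) :
        cornerWeight w M * ((X ab.1 M - v) * (X ab.2 M - v)) =
          cornerWeight w M * (X ab.1 M * X ab.2 M) - v * (cornerWeight w M * X ab.1 M) -
            v * (cornerWeight w M * X ab.2 M) + v ^ 2 * cornerWeight w M := by ring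
    rw [Finset.sum_congr rfl fun M _ => expand M, Finset.sum_add_distrib,
      Finset.sum_sub_distrib, Finset.sum_sub_distrib, ← Finset.mul_sum, ← Finset.mul_sum,
      ← Finset.mul_sum, hXX, hX, hX, e3, e1, e2, sum_cornerWeight hw]
    ring
  -- For overlapping choices the trivial bound suffices, because such pairs are rare.
  have hbad (ab : A × A) :
      ∑ M, cornerWeight w M * ((X ab.1 M - v) * (X ab.2 M - v)) ≤ 1 := by
    have hX1 (a : A) (M : SquareDescription N) : |X a M - v| ≤ 1 := by
      have h0 := hv01.1
      have h1 := hv01.2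
      rw [abs_le]
      simp only [X]
      split_ifs <;> constructor <;> linarith
    calc ∑ M, cornerWeight w M * ((X ab.1 M - v) * (X ab.2 M - v))
        ≤ ∑ M, cornerWeight w M := by
          refine Finset.sum_le_sum fun M _ =>
            mul_le_of_le_one_right (cornerWeight_nonneg hw M) ?_
          refine (le_abs_self _).trans ?_
          rw [abs_mul]
          exact mul_le_one₀ (hX1 _ M) (abs_nonneg _) (hX1 _ M)
      _ = 1 := sum_cornerWeight hw
  have hcount := descFactorial_mul_le_card L N n
  calc ∑ M, cornerWeight w M * (nabla M h - v) ^ 2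
      = κ ^ 2 * ∑ ab : A × A, ∑ M, cornerWeight w M * ((X ab.1 M - v) * (X ab.2 M - v)) := by
        rw [Finset.sum_comm, Finset.mul_sum]
        refine Finset.sum_congr rfl fun M _ => ?_
        rw [hsq, ← Finset.mul_sum]
        ring
    _ ≤ κ ^ 2 * ∑ ab : A × A, (1 - if good ab then 1 else 0) := by
        refine mul_le_mul_of_nonneg_left (Finset.sum_le_sum fun ab _ => ?_) (sq_nonneg _)
        split_ifs with hab
        · rw [hgood ab hab, sub_self]
        · rw [sub_zero]
          exact hbad ab
    _ = 1 - κ ^ 2 * (Finset.univ.filter good).card := by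
        rw [Finset.sum_sub_distrib, Finset.sum_boole, Finset.sum_const, Finset.card_univ,
          Fintype.card_prod, nsmul_eq_mul, mul_sub]
        push_cast
        linear_combination (κ * Fintype.card A + 1) * hcard
    _ ≤ 1 - κ ^ 2 * (N.descFactorial (2 * L.card) * N.descFactorial (2 * n)) := by
        refine sub_le_sub_left (mul_le_mul_of_nonneg_left ?_ (sq_nonneg _)) _
        exact_mod_cast hcount
    _ = _ := by
        simp only [κ]
        ring

end Corner

/-- Square descriptions that sample according to a given function satisfying ULi with WIP. -/
theorem exists_squareDescription_tendsto {L : Finset ℕ} {w : Sentence L → ℝ}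
    (hw : ULiWith (fun _ => WeakIrrelevance) w) :
    ∃ M : ∀ N, SquareDescription N, ∀ (n : ℕ) (h : Fin n → Atom L) (c : Fin n ↪ ℕ),
      Tendsto (fun N => nabla (M N) h) atTop (𝓝 (w (stateDescription h c))) := by
  obtain ⟨W, hW, hincl, rfl⟩ := hw
  have : ∀ n : ℕ, Countable (Fin n ↪ ℕ) := fun n =>
    (DFunLike.coe_injective (F := Fin n ↪ ℕ)).countable
  let T : Type := Σ n : ℕ, (Fin n → Atom L) × (Fin n ↪ ℕ)
  let g (t : T) (N : ℕ) (M : SquareDescription N) : ℝ :=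
    (nabla M t.2.1 - W L (stateDescription t.2.1 t.2.2)) ^ 2
  have hg (t : T) (N : ℕ) (M : SquareDescription N) : g t N M ∈ Set.Icc (0 : ℝ) 1 := by
    have h1 := nabla_mem_Icc M t.2.1
    have h2 := (hW L).1.mem_Icc (stateDescription t.2.1 t.2.2)
    refine ⟨sq_nonneg _, ?_⟩
    rw [sq_le_one_iff_abs_le_one, abs_le]
    constructor <;> linarith [h1.1, h1.2, h2.1, h2.2]
  have hlim (t : T) :
      Tendsto (fun N => ∑ M, cornerWeight (W (Finset.range N)) M * g t N M) atTop (𝓝 0) := by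
    obtain ⟨n, h, c⟩ := t
    have hlim := ((tendsto_descFactorial_div_pow (2 * L.card)).mul
      (tendsto_descFactorial_div_pow (2 * n))).const_sub 1
    rw [one_mul, sub_self] at hlim
    refine tendsto_of_tendsto_of_tendsto_of_le_of_le' tendsto_const_nhds hlim
      (.of_forall fun N => Finset.sum_nonneg fun M _ =>
        mul_nonneg (cornerWeight_nonneg (hW _).1 M) (sq_nonneg _)) ?_
    -- From this `N` on, all predicates of `L` have index below `N`; language invariance then
    -- compares `W L` with `W (Finset.range N)`.
    filter_upwards [eventually_ge_atTop (L.sup id + 1)] with N hN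
    have hL : L ⊆ Finset.range N := fun P hP => by
      have := Finset.le_sup (f := id) hP
      simp only [id] at this
      exact Finset.mem_range.2 (by omega)
    obtain ⟨h1, h2, h3, h4⟩ := hW (Finset.range N)
    have := sum_cornerWeight_mul_sq_le (by omega) h1 h2 h3 h4 hL h c
    rwa [hincl] at this
  obtain ⟨M, hM⟩ := exists_seq_tendsto_zero
    (.of_forall fun N => ⟨cornerWeight_nonneg (hW _).1, sum_cornerWeight (hW _).1⟩) hg hlim
  refine ⟨M, fun n h c => ?_⟩
  have h1 := (hM ⟨n, h, c⟩).sqrt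
  simp only [g, Real.sqrt_sq_eq_abs, Real.sqrt_zero] at h1
  exact tendsto_sub_nhds_zero_iff.1 ((tendsto_zero_iff_abs_tendsto_zero _).2 h1)

/-- A representative of ν tends to infinity along `U`, so composing it with the convergent sequence
of matrices gives a description of size exactly ν. -/
theorem exists_isStdNabla_of_uliWith {ι : Type*} {U : Ultrafilter ι}
    {ν : (U : Filter ι).Germ ℕ} (hν : ∀ n : ℕ, (Germ.const n : (U : Filter ι).Germ ℕ) < ν)
    {L : Finset ℕ} {w : Sentence L → ℝ} (hw : IsProbabilityFunction w)
    (h : ULiWith (fun _ => WeakIrrelevance) w) :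
    ∃ Υ : HyperDescription U ν, IsStdNabla Υ w := by
  obtain ⟨M, hM⟩ := exists_squareDescription_tendsto h
  induction ν using Germ.inductionOn with
  | _ f =>
  let Υ : ι → Σ N, SquareDescription N := fun i => ⟨f i, M (f i)⟩
  refine ⟨⟨(Υ : (U : Filter ι).Germ _), rfl⟩, hw, fun n d c => ?_⟩
  exact (stdPart_germ_eq (f := fun i => nabla (Υ i).2 d)
    ((hM n d c).comp (tendsto_atTop_of_const_lt hν))).symm

end PIL

theorem theorem4p3 {ι : Type*} (U : Ultrafilter ι) (ν : (U : Filter ι).Germ ℕ)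
    (hν : ∀ n : ℕ, (Filter.Germ.const n : (U : Filter ι).Germ ℕ) < ν) (L : Finset ℕ) :
    (∀ Υ : PIL.HyperDescription U ν, ∃! w : PIL.Sentence L → ℝ, PIL.IsStdNabla Υ w) ∧
    (∀ w : PIL.Sentence L → ℝ, PIL.IsProbabilityFunction w →
      (PIL.ULiWith (fun _ => PIL.WeakIrrelevance) w ↔
        ∃ Υ : PIL.HyperDescription U ν, PIL.IsStdNabla Υ w)) := by
  refine ⟨fun Υ => ?_, fun w hw => ⟨PIL.exists_isStdNabla_of_uliWith hν hw, ?_⟩⟩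
  · obtain ⟨μ, -, -, hμ⟩ := PIL.exists_measure_isStdNabla hν Υ
    exact ⟨_, hμ L, fun w hw => hw.unique (hμ L)⟩
  · rintro ⟨Υ, hΥ⟩
    obtain ⟨μ, h1, h2, hμ⟩ := PIL.exists_measure_isStdNabla hν Υ
    -- Agreement on state descriptions gives agreement on all sentences, so `w` itself comes from
    -- the measure `μ`.
    rw [hΥ.unique (hμ L)]
    exact PIL.uliWith_measure h1 h2
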